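/- Let $B$ be the bi-invariant metric on $SU(3)$ given by the negative of the Killing form, and let $I$ be a left-invariant (integrable) complex structure on $SU(3)$ that is orthogonal for $B$. Then there is a maximal torus of $SU(3)$, with Lie algebra $\mathfrak t$, and a choice of positive roots $\alpha,\beta,\alpha+\beta$, with $\alpha,\beta$ simple, such that the complex-linear extension of $I$ satisfies $I(E_\gamma)=iE_\gamma$ for every root vector $E_\gamma$ of a positive root $\gamma$. For every such torus and choice of positive roots the following holds. For $\lambda_\alpha,\lambda_\beta,\lambda_{\alpha+\beta}>0$ let $\Lambda$ be the operator on $\mathfrak{su}(3)$ that is the identity on $\mathfrak t$ and whose complex-linear extension is multiplication by $\lambda_\gamma$ on the root spaces of $\pm\gamma$, for $\gamma\in\{\alpha,\beta,\alpha+\beta\}$. Then $g=B(\Lambda\cdot,\cdot)$ is a left-invariant Riemannian metric, Hermitian for $I$ and invariant under right translations by the torus, and $(g,I)$ is CYT, i.e. the Ricci form $\rho^B(X,Y)=\sum_i g(R(X,Y)E_i,IE_i)$ ($E_i$ a $g$-orthonormal frame) of its Bismut connection (the connection that preserves $g$ and $I$ and has totally skew-symmetric torsion) vanishes, if and only if $$\frac1{\lambda_\alpha}+\frac1{\lambda_{\alpha+\beta}}=\frac1{\lambda_\beta}+\frac1{\lambda_{\alpha+\beta}}=2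 .$$ Consequently the invariant CYT metrics of the form $B(\Lambda\cdot,\cdot)$ form a one-parameter family, parametrized bijectively by $t\in(0,2)$ through $\lambda_\alpha=\lambda_\beta=1/t$, $\lambda_{\alpha+\beta}=1/(2-t)$. -/

import Mathlib

open scoped ContDiff Matrix

attribute [local instance] Matrix.linftyOpNormedAddCommGroup Matrix.linftyOpNormedSpace

noncomputable section

namespace SU3Geometry

/-- Complex `3 × 3` matrices. -/
abbrev Mat3 : Type := Matrix (Fin 3) (Fin 3) ℂ

/-- The group `SU(3)`. -/
abbrev SU3 : Type := Matrix.specialUnitaryGroup (Fin 3) ℂ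

/-- The real Lie algebra `𝔰𝔲(3)` of traceless skew-Hermitian matrices, the tangent space of
`SU(3)` at the identity. The tangent space at `p` is `p · 𝔰𝔲(3)`. -/
def su3 : Submodule ℝ Mat3 where
  carrier := {A | Aᴴ = -A ∧ A.trace = 0}
  add_mem' := by
    rintro A B ⟨hA, hA'⟩ ⟨hB, hB'⟩
    refine ⟨?_, ?_⟩
    · rw [Matrix.conjTranspose_add, hA, hB, neg_add]
    · rw [Matrix.trace_add, hA', hB', add_zero]
  zero_mem' := by simp
  smul_mem' := by
    rintro c A ⟨hA, hA'⟩
    refine ⟨?_, ?_⟩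
    · rw [Matrix.conjTranspose_smul, hA, star_trivial, smul_neg]
    · rw [Matrix.trace_smul, hA', smul_zero]

/-- The commutator on `𝔰𝔲(3)`. -/
def bracket (A B : su3) : su3 :=
  ⟨(A : Mat3) * B - B * A, by
    obtain ⟨A, hA, hA'⟩ := A
    obtain ⟨B, hB, hB'⟩ := B
    refine ⟨?_, ?_⟩
    · simp only [Matrix.conjTranspose_sub, Matrix.conjTranspose_mul, hA, hB]
      simp
    · simp only [Matrix.trace_sub]
      rw [Matrix.trace_mul_comm, sub_self]⟩

theorem exp_mem (A : su3) : NormedSpace.exp (A : Mat3) ∈ Matrix.specialUnitaryGroup (Fin 3) ℂ := by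
  obtain ⟨A, hA, hA'⟩ := A
  rw [Matrix.mem_specialUnitaryGroup_iff]
  refine ⟨?_, ?_⟩
  · rw [Matrix.mem_unitaryGroup_iff, Matrix.star_eq_conjTranspose, ← Matrix.exp_conjTranspose]
    simp only [hA, Matrix.exp_neg]
    exact Matrix.mul_nonsing_inv _
      ((Matrix.isUnit_iff_isUnit_det _).1 (Matrix.isUnit_exp A))
  · have hH : (Complex.I • A).IsHermitian := by
      rw [Matrix.IsHermitian, Matrix.conjTranspose_smul, hA]
      simp
    have hs := hH.spectral_theorem
    rw [Unitary.conjStarAlgAut_apply] at hs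
    have hu : IsUnit (hH.eigenvectorUnitary : Mat3) :=
      ⟨Unitary.toUnits hH.eigenvectorUnitary, rfl⟩
    have hinv : star (hH.eigenvectorUnitary : Mat3) = (hH.eigenvectorUnitary : Mat3)⁻¹ :=
      (Matrix.inv_eq_right_inv (Unitary.coe_mul_star_self _)).symm
    have hA2 : A = (hH.eigenvectorUnitary : Mat3) *
        Matrix.diagonal (fun i => -Complex.I * (hH.eigenvalues i : ℂ)) *
        (hH.eigenvectorUnitary : Mat3)⁻¹ := by
      have h1 : A = (-Complex.I) • (Complex.I • A) := by
        rw [smul_smul]; simp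
      refine h1.trans ?_
      conv_lhs => rw [hs]
      rw [hinv, ← smul_mul_assoc, ← mul_smul_comm, ← Matrix.diagonal_smul]
      rfl
    have htr : ∑ i, (hH.eigenvalues i : ℂ) = 0 := by
      have := hH.trace_eq_sum_eigenvalues
      rw [Matrix.trace_smul, hA', smul_zero] at this
      exact this.symm
    change (NormedSpace.exp A).det = 1
    rw [hA2, Matrix.exp_conj _ _ hu, Matrix.det_conj hu, Matrix.exp_diagonal, Matrix.det_diagonal]
    have : ∀ i, NormedSpace.exp (fun i => -Complex.I * (hH.eigenvalues i : ℂ)) i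
        = Complex.exp (-Complex.I * (hH.eigenvalues i : ℂ)) := by
      intro i
      rw [Pi.coe_exp, Complex.exp_eq_exp_ℂ]
    simp only [this]
    rw [← Complex.exp_sum, ← Finset.mul_sum, htr]
    simp

/-- The exponential map `𝔰𝔲(3) → SU(3)`. -/
def expSU3 (A : su3) : SU3 := ⟨NormedSpace.exp (A : Mat3), exp_mem A⟩

/-- The adjoint action `X ↦ V X V⁻¹` of `SU(3)` on `𝔰𝔲(3)`. -/
def Ad (V : SU3) (X : su3) : su3 :=
  ⟨(V : Mat3) * X * (V : Mat3)ᴴ, by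
    obtain ⟨X, hX, hX'⟩ := X
    have hV : (V : Mat3)ᴴ * (V : Mat3) = 1 :=
      Matrix.mem_unitaryGroup_iff'.1 (Matrix.mem_specialUnitaryGroup_iff.1 V.2).1
    refine ⟨?_, ?_⟩
    · simp [Matrix.conjTranspose_mul, hX, Matrix.mul_assoc]
    · rw [Matrix.trace_mul_comm, ← Matrix.mul_assoc, hV, Matrix.one_mul, hX']⟩

/-! ### Calculus on the group

`SU(3)` is a closed embedded submanifold of the space of matrices, so a function on it is smooth
exactly when it is the restriction of a smooth function of matrices. The tangent bundle is
trivialized by left translations: a function `X : SU3 → su3` stands for the vector field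
`p ↦ p · X p`, and constant functions stand for the left-invariant fields. -/

section Calculus

variable {V : Type*} [NormedAddCommGroup V] [NormedSpace ℝ V]

/-- Smooth functions on `SU(3)`. -/
def IsSmooth (f : SU3 → V) : Prop :=
  ∃ F : Mat3 → V, ContDiff ℝ ∞ F ∧ ∀ p : SU3, F (p : Mat3) = f p

/-- The derivative `(X f)(p) = d/dt f(p exp(t X(p)))` at `t = 0` of a function `f` along the
vector field `X`. -/
def fieldDeriv (X : SU3 → su3) (f : SU3 → V) (p : SU3) : V :=
  deriv (fun t : ℝ => f (p * expSU3 (t • X p))) 0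

end Calculus

/-- The Lie bracket of vector fields, in the left trivialization. -/
def fieldBracket (X Y : SU3 → su3) (p : SU3) : su3 :=
  fieldDeriv X Y p - fieldDeriv Y X p + bracket (X p) (Y p)

/-- Affine connections on `SU(3)`; `D X Y` is the covariant derivative of `Y` along `X`
(only its values on smooth fields matter). -/
structure IsConnection (D : (SU3 → su3) → (SU3 → su3) → SU3 → su3) : Prop where
  smooth : ∀ X Y, IsSmooth X → IsSmooth Y → IsSmooth (D X Y)
  add_left : ∀ X X' Y, IsSmooth X → IsSmooth X' → IsSmooth Y →
    D (X + X') Y = D X Y + D X' Y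
  smul_left : ∀ (f : SU3 → ℝ) (X Y), IsSmooth f → IsSmooth X → IsSmooth Y →
    D (fun p => f p • X p) Y = fun p => f p • D X Y p
  add_right : ∀ X Y Y', IsSmooth X → IsSmooth Y → IsSmooth Y' →
    D X (Y + Y') = D X Y + D X Y'
  leibniz : ∀ (f : SU3 → ℝ) (X Y), IsSmooth f → IsSmooth X → IsSmooth Y →
    D X (fun p => f p • Y p) = fun p => fieldDeriv X f p • Y p + f p • D X Y p

/-- The torsion of a connection. -/
def torsion (D : (SU3 → su3) → (SU3 → su3) → SU3 → su3) (X Y : SU3 → su3) (p : SU3) : su3 :=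
  D X Y p - D Y X p - fieldBracket X Y p

/-- The curvature `R(X,Y)Z` of a connection. -/
def curvature (D : (SU3 → su3) → (SU3 → su3) → SU3 → su3) (X Y Z : SU3 → su3) (p : SU3) : su3 :=
  D X (D Y Z) p - D Y (D X Z) p - D (fieldBracket X Y) Z p

/-! ### Left-invariant structures

A left-invariant tensor field is constant in the left trivialization, hence is given by a tensor
on `𝔰𝔲(3)`. -/

/-- The left-invariant endomorphism field `J` is an integrable complex structure: `J² = -1` and
its Nijenhuis tensor vanishes. -/
structure IsInvariantComplexStructure (J : su3 →ₗ[ℝ] su3) : Prop where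
  sq_eq_neg : ∀ X, J (J X) = -X
  nijenhuis : ∀ X Y : SU3 → su3, IsSmooth X → IsSmooth Y → ∀ p,
    fieldBracket (fun q => J (X q)) (fun q => J (Y q)) p
      - J (fieldBracket (fun q => J (X q)) Y p) - J (fieldBracket X (fun q => J (Y q)) p)
      - fieldBracket X Y p = 0

/-- The left-invariant tensor field `g` is a Riemannian metric that is Hermitian for `J`. -/
structure IsInvariantHermitianMetric (J : su3 →ₗ[ℝ] su3) (g : su3 →ₗ[ℝ] su3 →ₗ[ℝ] ℝ) : Prop where
  symm : ∀ X Y, g X Y = g Y X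
  pos : ∀ X, X ≠ 0 → 0 < g X X
  hermitian : ∀ X Y, g (J X) (J Y) = g X Y

/-- `D` is the Bismut (KT) connection of `(g, J)`: it preserves `g` and `J` and its torsion is
totally skew-symmetric. -/
structure IsBismutConnection (J : su3 →ₗ[ℝ] su3) (g : su3 →ₗ[ℝ] su3 →ₗ[ℝ] ℝ)
    (D : (SU3 → su3) → (SU3 → su3) → SU3 → su3) : Prop extends IsConnection D where
  metric : ∀ X Y Z, IsSmooth X → IsSmooth Y → IsSmooth Z → ∀ p,
    fieldDeriv X (fun q => g (Y q) (Z q)) p = g (D X Y p) (Z p) + g (Y p) (D X Z p)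
  complex : ∀ X Y, IsSmooth X → IsSmooth Y → ∀ p, D X (fun q => J (Y q)) p = J (D X Y p)
  skew : ∀ X Y Z, IsSmooth X → IsSmooth Y → IsSmooth Z → ∀ p,
    g (torsion D X Y p) (Z p) = -g (torsion D X Z p) (Y p)

/-- The Ricci form `ρ(X,Y) = ∑ᵢ g(R(X,Y)Eᵢ, J Eᵢ)` of a connection, where `E` is a frame of
left-invariant fields (to be taken `g`-orthonormal). -/
def ricciForm {ι : Type*} [Fintype ι] (J : su3 →ₗ[ℝ] su3) (g : su3 →ₗ[ℝ] su3 →ₗ[ℝ] ℝ)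
    (D : (SU3 → su3) → (SU3 → su3) → SU3 → su3) (E : ι → su3) (X Y : SU3 → su3) (p : SU3) : ℝ :=
  ∑ i, g (curvature D X Y (fun _ => E i) p) (J (E i))

/-- `(g, J)` is Calabi-Yau with torsion: the Ricci form of the Bismut connection vanishes. -/
def IsCYT (J : su3 →ₗ[ℝ] su3) (g : su3 →ₗ[ℝ] su3 →ₗ[ℝ] ℝ) : Prop :=
  ∃ D, IsBismutConnection J g D ∧
    ∀ E : Module.Basis (Fin (Module.finrank ℝ su3)) ℝ su3,
      (∀ i j, g (E i) (E j) = if i = j then 1 else 0) →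
      ∀ X Y, IsSmooth X → IsSmooth Y → ∀ p, ricciForm J g D E X Y p = 0

/-! ### Deformations of the bi-invariant metric -/

/-- The bi-invariant metric `B`, the negative `-6 tr(XY)` of the Killing form. -/
def B : su3 →ₗ[ℝ] su3 →ₗ[ℝ] ℝ :=
  LinearMap.mk₂ ℝ (fun X Y => -6 * ((X : Mat3) * (Y : Mat3)).trace.re)
    (by intro X X' Y; simp [Matrix.add_mul]; ring)
    (by intro c X Y; simp; ring)
    (by intro X Y Y'; simp [Matrix.mul_add]; ring)
    (by intro c X Y; simp; ring)

/-- A unitary frame `U` determines the maximal torus of the matrices that are diagonal in this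
frame, the root vectors `U E_{jk} U⁻¹` and the positive roots `j < k`. It is adapted to `J` if the
complex-linear extension of `J` acts as multiplication by `i` on all positive root vectors. Here
`X + iY` with `X Y : su3` is the decomposition of `U E_{jk} U⁻¹` in the complexification
`𝔰𝔩(3, ℂ)` of `𝔰𝔲(3)`, which exists and is unique. -/
def IsAdapted (J : su3 →ₗ[ℝ] su3) (U : SU3) : Prop :=
  ∀ j k : Fin 3, j < k → ∃ X Y : su3,
    (X : Mat3) + Complex.I • (Y : Mat3) = (U : Mat3) * Matrix.single j k 1 * (U : Mat3)ᴴ ∧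
    ((J X : su3) : Mat3) + Complex.I • ((J Y : su3) : Mat3)
      = Complex.I • ((X : Mat3) + Complex.I • (Y : Mat3))

/-- The matrix of eigenvalues of `Λ`: `1` on the Cartan subalgebra, `a` on the root spaces
`±α`, where `α = e₁ - e₂`, `b` on those of `±β`, where `β = e₂ - e₃`, and `c` on those of
`±(α + β)`. -/
def weights (a b c : ℝ) : Mat3 := !![1, (a : ℂ), (c : ℂ); (a : ℂ), 1, (b : ℂ); (c : ℂ), (b : ℂ), 1]

theorem Lam_mem (U : SU3) (a b c : ℝ) (X : su3) :
    (U : Mat3) * (weights a b c ⊙ ((U : Mat3)ᴴ * X * (U : Mat3))) * (U : Mat3)ᴴ ∈ su3 := by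
  obtain ⟨X, hX, hX'⟩ := X
  have hU : (U : Mat3)ᴴ * (U : Mat3) = 1 :=
    Matrix.mem_unitaryGroup_iff'.1 (Matrix.mem_specialUnitaryGroup_iff.1 U.2).1
  have hU' : (U : Mat3) * (U : Mat3)ᴴ = 1 :=
    Matrix.mem_unitaryGroup_iff.1 (Matrix.mem_specialUnitaryGroup_iff.1 U.2).1
  have hY : ((U : Mat3)ᴴ * X * (U : Mat3))ᴴ = -((U : Mat3)ᴴ * X * (U : Mat3)) := by
    simp [Matrix.conjTranspose_mul, hX, Matrix.mul_assoc]
  have hW : (weights a b c ⊙ ((U : Mat3)ᴴ * X * (U : Mat3)))ᴴ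
      = -(weights a b c ⊙ ((U : Mat3)ᴴ * X * (U : Mat3))) := by
    ext i j
    have h := congrFun (congrFun hY i) j
    rw [Matrix.conjTranspose_apply, Matrix.neg_apply] at h
    rw [Matrix.conjTranspose_apply, Matrix.neg_apply, Matrix.hadamard_apply,
      Matrix.hadamard_apply, star_mul', h]
    fin_cases i <;> fin_cases j <;> simp [weights]
  refine ⟨?_, ?_⟩
  · rw [Matrix.conjTranspose_mul, Matrix.conjTranspose_mul, hW]
    simp [Matrix.mul_assoc]
  · rw [Matrix.trace_mul_comm, ← Matrix.mul_assoc, hU, Matrix.one_mul]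
    have h1 : (weights a b c ⊙ ((U : Mat3)ᴴ * X * (U : Mat3))).trace
        = ((U : Mat3)ᴴ * X * (U : Mat3)).trace := by
      simp [Matrix.trace, Fin.sum_univ_three, weights]
    rw [h1, Matrix.trace_mul_comm, ← Matrix.mul_assoc, hU', Matrix.one_mul]
    exact hX'

/-- The operator `Λ`: the identity on the Cartan subalgebra of the frame `U`, and multiplication
by `λ_α = a`, `λ_β = b`, `λ_{α+β} = c` on the root spaces. -/
def Lam (U : SU3) (a b c : ℝ) : su3 →ₗ[ℝ] su3 where
  toFun X := ⟨(U : Mat3) * (weights a b c ⊙ ((U : Mat3)ᴴ * X * (U : Mat3))) * (U : Mat3)ᴴ,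
    Lam_mem U a b c X⟩
  map_add' X Y := by
    apply Subtype.ext
    simp [Matrix.mul_add, Matrix.add_mul, Matrix.hadamard_add]
  map_smul' r X := by
    apply Subtype.ext
    simp [Matrix.hadamard_smul]

/-- The metric `B(Λ·,·)`. -/
def metric (U : SU3) (a b c : ℝ) : su3 →ₗ[ℝ] su3 →ₗ[ℝ] ℝ := B ∘ₗ Lam U a b c

/-- The left-invariant metric `g` is also invariant under right translations by the maximal torus
of the frame `U`. -/
def IsTorusInvariant (U : SU3) (g : su3 →ₗ[ℝ] su3 →ₗ[ℝ] ℝ) : Prop :=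
  ∀ V : SU3, ((U : Mat3)ᴴ * (V : Mat3) * (U : Mat3)).IsDiag →
    ∀ X Y, g (Ad V X) (Ad V Y) = g X Y

end SU3Geometry

end

/-! Adapted frame. Let `q` be the `i`-eigenspace of the complexified `J`, i.e. the matrices `X -
iJX`. Integrability makes `q` a Lie subalgebra, and `B`-orthogonality makes the trace form vanish on
it. By Cartan's criterion `q` is solvable, and by Lie's theorem it stabilizes a full flag of `ℂ³`,
so it is upper triangular in a suitable unitary frame (`LieSubalgebra.exists_flag`,
`exists_SU3_triangular`). The root vectors `E_{jk}`, `j < k`, in this frame are then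
trace-orthogonal to `q`. Since `J` is skew for `B`, this already forces them to lie in `q`.

CYT condition. On left-invariant fields the Bismut connection is a bilinear product `Γ` on `𝔰𝔲(3)`,
unique by `product_unique`. As `J` commutes with every `Γ X`, the commutator part of the curvature
drops out of the Ricci form, leaving `ρ(X,Y) = tr(J Γ_{[X,Y]})`. Summing the explicit formula for
`Γ` over an orthonormal frame (`trace_bismut`) and using the ad-invariance of `B`
(`sum_metric_bracket`) gives `tr(J Γ_Z) = tr(J ad Z) - tr(Λ⁻¹ J ad(ΛZ))`. Only root spaces and the
Cartan part of `Z` contribute (`IsAdapted.trace_sub_trace`), so up to a constant this is `∑ (1 -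
1/λ_γ) γ(Z)` over the positive roots. Brackets of root vectors span the Cartan subalgebra, so CYT
means that this combination of roots is zero. Comparing the coefficients of `α` and `β` yields the
two equations. -/

/-! ### Lie algebras with vanishing trace form -/

section LieTheory

attribute [local instance] LieRing.ofAssociativeRing

/-- A Lie algebra of endomorphisms whose trace form vanishes is solvable. -/
theorem LieSubalgebra.isSolvable_of_trace_mul_eq_zero {k V : Type*} [Field k] [CharZero k]
    [AddCommGroup V] [Module k V] [FiniteDimensional k V] (L : LieSubalgebra k (Module.End k V))
    (h : ∀ f ∈ L, ∀ g ∈ L, LinearMap.trace k V (f * g) = 0) : LieAlgebra.IsSolvable L := by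
  have htf : LieModule.traceForm k L V = 0 := by
    ext ⟨x, hx⟩ ⟨y, hy⟩
    exact h x hx y hy
  -- Cartan's criterion: when the trace form vanishes, the derived ideal acts on `V` by nilpotent
  -- endomorphisms.
  have hnil : LieModule.IsNilpotent (LieAlgebra.derivedSeries k L 1) V :=
    LieModule.isNilpotent_derivedSeries_of_traceForm_eq_zero htf
  -- Nilpotent endomorphisms have nilpotent `ad`, so Engel's theorem applies to the derived ideal.
  have hring : LieRing.IsNilpotent (LieAlgebra.derivedSeries k L 1) := by
    rw [LieAlgebra.isNilpotent_iff_forall (R := k)]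
    rintro ⟨x, hx⟩
    apply LieSubalgebra.isNilpotent_ad_of_isNilpotent_ad
      (LieAlgebra.derivedSeries k L 1 : LieSubalgebra k L) (x := ⟨x, hx⟩)
    apply LieAlgebra.isNilpotent_ad_of_isNilpotent
    exact (LieModule.isNilpotent_iff_forall' (R := k)).mp hnil ⟨x, hx⟩
  obtain ⟨m, hm⟩ := LieAlgebra.IsSolvable.solvable k (LieAlgebra.derivedSeries k L 1)
  rw [LieIdeal.derivedSeries_eq_bot_iff] at hm
  refine LieAlgebra.IsSolvable.mk (k := m + 1) (R := k) ?_
  rwa [LieAlgebra.derivedSeries_def, LieAlgebra.derivedSeriesOfIdeal_add]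

/-- A solvable Lie algebra of endomorphisms has a common eigenvector in an invariant hyperplane. -/
theorem LieSubalgebra.exists_eigenvector_eigencovector {k V : Type*} [Field k] [CharZero k]
    [IsAlgClosed k] [AddCommGroup V] [Module k V] [FiniteDimensional k V]
    (hV : 2 ≤ Module.finrank k V) (L : LieSubalgebra k (Module.End k V))
    [LieAlgebra.IsSolvable L] :
    ∃ (v : V) (φ : Module.Dual k V), v ≠ 0 ∧ φ ≠ 0 ∧ φ v = 0 ∧
      ∀ f ∈ L, (∃ c : k, f v = c • v) ∧ ∃ d : k, ∀ x, φ (f x) = d * φ x := by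
  have : Nontrivial V := Module.nontrivial_of_finrank_pos (R := k) (by omega)
  -- Lie's theorem is used twice: on the dual it gives `φ`, and then on the invariant subspace `ker
  -- φ`, nonzero because `dim V ≥ 2`, it gives `v`.
  obtain ⟨χ, hχ⟩ := LieModule.exists_nontrivial_weightSpace_of_isSolvable k L (Module.Dual k V)
  obtain ⟨⟨φ, hφ⟩, hφ0⟩ := exists_ne (0 : LieModule.weightSpace (Module.Dual k V) χ)
  rw [LieModule.mem_weightSpace] at hφ
  have hφ0 : φ ≠ 0 := fun h => hφ0 (Subtype.ext h)
  have hφ' : ∀ f : L, ∀ x, φ (f.1 x) = -χ f * φ x := by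
    intro f x
    have h1 : ⁅f, φ⁆ x = χ f * φ x := by rw [hφ f]; rfl
    rw [Module.Dual.lie_apply] at h1
    change -φ (f.1 x) = _ at h1
    rw [neg_mul, ← h1, neg_neg]
  let P : LieSubmodule k L V :=
    { toSubmodule := LinearMap.ker φ
      lie_mem := by
        intro f x hx
        have hx : φ x = 0 := hx
        change φ (f.1 x) = 0
        rw [hφ', hx, mul_zero] }
  have hP : Nontrivial P := by
    apply Module.nontrivial_of_finrank_pos (R := k)
    have := LinearMap.finrank_range_add_finrank_ker φ
    have h2 : Module.finrank k (LinearMap.range φ) ≤ 1 :=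
      (Submodule.finrank_le _).trans_eq (Module.finrank_self k)
    change 0 < Module.finrank k (LinearMap.ker φ)
    omega
  obtain ⟨ψ, hψ⟩ := LieModule.exists_nontrivial_weightSpace_of_isSolvable k L P
  obtain ⟨⟨⟨v, hvP⟩, hv⟩, hv0⟩ := exists_ne (0 : LieModule.weightSpace P ψ)
  rw [LieModule.mem_weightSpace] at hv
  refine ⟨v, φ, ?_, hφ0, hvP, fun f hf => ⟨⟨ψ ⟨f, hf⟩, ?_⟩, ⟨-χ ⟨f, hf⟩, hφ' ⟨f, hf⟩⟩⟩⟩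
  · rintro rfl
    exact hv0 rfl
  · exact congrArg Subtype.val (hv ⟨f, hf⟩)

/-- A Lie algebra of complex `3 × 3` matrices with vanishing trace form has a common eigenvector
that is annihilated by a common left eigenvector. -/
theorem LieSubalgebra.exists_flag (q : LieSubalgebra ℂ (Matrix (Fin 3) (Fin 3) ℂ))
    (h : ∀ M ∈ q, ∀ N ∈ q, (M * N).trace = 0) :
    ∃ v w : Fin 3 → ℂ, v ≠ 0 ∧ w ≠ 0 ∧ w ⬝ᵥ v = 0 ∧
      ∀ M ∈ q, (∃ c : ℂ, M *ᵥ v = c • v) ∧ ∃ d : ℂ, w ᵥ* M = d • w := by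
  let e : Matrix (Fin 3) (Fin 3) ℂ ≃ₗ⁅ℂ⁆ Module.End ℂ (Fin 3 → ℂ) := lieEquivMatrix'.symm
  let L := q.map e.toLieHom
  have hL : LieAlgebra.IsSolvable L := by
    apply LieSubalgebra.isSolvable_of_trace_mul_eq_zero
    rintro _ ⟨M, hM, rfl⟩ _ ⟨N, hN, rfl⟩
    change LinearMap.trace ℂ _ (Matrix.toLin' M * Matrix.toLin' N) = 0
    rw [Module.End.mul_eq_comp, ← Matrix.toLin'_mul, Matrix.trace_toLin'_eq, h M hM N hN]
  obtain ⟨v, φ, hv, hφ, hφv, H⟩ := L.exists_eigenvector_eigencovector (by simp)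
  let w : Fin 3 → ℂ := fun i => φ (Pi.single i 1)
  have hw : ∀ x, φ x = w ⬝ᵥ x := by
    intro x
    conv_lhs => rw [← Finset.univ_sum_single x]
    rw [map_sum, dotProduct]
    refine Finset.sum_congr rfl fun i _ => ?_
    have : Pi.single i (x i) = x i • (Pi.single i 1 : Fin 3 → ℂ) := by
      rw [← Pi.single_smul, smul_eq_mul, mul_one]
    rw [this, map_smul, smul_eq_mul, mul_comm]
  refine ⟨v, w, hv, ?_, by rw [← hw, hφv], fun M hM => ?_⟩
  · intro h0
    apply hφ
    ext i
    exact congrFun h0 i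
  · obtain ⟨⟨c, hc⟩, d, hd⟩ := H (e M) ⟨M, hM, rfl⟩
    refine ⟨⟨c, hc⟩, d, ?_⟩
    ext i
    have h1 := hd (Pi.single i 1)
    rw [hw, hw] at h1
    change w ⬝ᵥ (M *ᵥ Pi.single i 1) = _ at h1
    rw [Matrix.dotProduct_mulVec] at h1
    simpa using h1

end LieTheory

namespace SU3Geometry

/-! ### Unitary frames -/

theorem conjTranspose_mul_self (U : SU3) : (U : Mat3)ᴴ * (U : Mat3) = 1 :=
  Matrix.mem_unitaryGroup_iff'.1 (Matrix.mem_specialUnitaryGroup_iff.1 U.2).1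

theorem mul_conjTranspose_self (U : SU3) : (U : Mat3) * (U : Mat3)ᴴ = 1 :=
  Matrix.mem_unitaryGroup_iff.1 (Matrix.mem_specialUnitaryGroup_iff.1 U.2).1

theorem exists_smul_star_dotProduct_eq_one {v : Fin 3 → ℂ} (hv : v ≠ 0) :
    ∃ a : ℂ, star (a • v) ⬝ᵥ (a • v) = 1 := by
  have hpos : 0 < ∑ i, Complex.normSq (v i) := by
    obtain ⟨i, hi⟩ := Function.ne_iff.1 hv
    exact Finset.sum_pos' (fun i _ => Complex.normSq_nonneg _)
      ⟨i, Finset.mem_univ _, Complex.normSq_pos.2 hi⟩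
  set n := ∑ i, Complex.normSq (v i) with hn
  have h1 : star v ⬝ᵥ v = (n : ℂ) := by
    simp [hn, dotProduct, Complex.normSq_eq_conj_mul_self]
  refine ⟨((Real.sqrt n)⁻¹ : ℝ), ?_⟩
  rw [star_smul, smul_dotProduct, dotProduct_smul, h1]
  have h2 : (Real.sqrt n)⁻¹ * ((Real.sqrt n)⁻¹ * n) = 1 := by
    have h3 : Real.sqrt n ≠ 0 := (Real.sqrt_pos.2 hpos).ne'
    nth_rewrite 3 [← Real.mul_self_sqrt hpos.le]
    field_simp
  simp only [smul_eq_mul]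
  rw [show star (((Real.sqrt n)⁻¹ : ℝ) : ℂ) = (((Real.sqrt n)⁻¹ : ℝ) : ℂ) from
    Complex.conj_ofReal _]
  exact_mod_cast h2

/-- Orthonormal vectors are the first and last column of a matrix in `SU(3)`. -/
theorem exists_SU3_col {x z : Fin 3 → ℂ} (hx : star x ⬝ᵥ x = 1) (hz : star z ⬝ᵥ z = 1)
    (hzx : star z ⬝ᵥ x = 0) : ∃ U : SU3, (U : Mat3).col 0 = x ∧ (U : Mat3).col 2 = z := by
  -- The conjugated cross product is Hermitian-orthogonal to `x` and `z`, and with this order of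
  -- factors the determinant is `y ⬝ᵥ (z × x) = star y ⬝ᵥ y = 1`.
  set y : Fin 3 → ℂ := star (crossProduct z x) with hy
  have hxz : star x ⬝ᵥ z = 0 := by
    rw [← star_star (star x ⬝ᵥ z), Matrix.star_dotProduct, star_star, hzx,
      star_zero]
  have hsy : star y = crossProduct z x := star_star _
  have hy' : y = crossProduct (star z) (star x) := by
    rw [hy]
    ext i
    fin_cases i <;> simp [cross_apply]
  have hyy : star y ⬝ᵥ y = 1 := by
    rw [hsy, hy', cross_dot_cross, dotProduct_comm z, dotProduct_comm x, hz, hx,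
      dotProduct_comm z, hxz]
    ring
  have hyx : star y ⬝ᵥ x = 0 := by rw [hsy, dotProduct_comm, dot_cross_self]
  have hyz : star y ⬝ᵥ z = 0 := by rw [hsy, dotProduct_comm, dot_self_cross]
  have hxy : star x ⬝ᵥ y = 0 := by rw [hy', dot_cross_self]
  have hzy : star z ⬝ᵥ y = 0 := by rw [hy', dot_self_cross]
  let U : Mat3 := (Matrix.of ![x, y, z])ᵀ
  have hU : Uᴴ * U = 1 := by
    ext i j
    have : (Uᴴ * U) i j = star (![x, y, z] i) ⬝ᵥ (![x, y, z] j) := rfl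
    rw [this]
    fin_cases i <;> fin_cases j <;> simp_all
  have hdet : U.det = 1 := by
    rw [Matrix.det_transpose]
    have h := triple_product_eq_det x y z
    rw [triple_product_permutation, ← hsy, dotProduct_comm, hyy] at h
    exact h.symm
  refine ⟨⟨U, Matrix.mem_specialUnitaryGroup_iff.2
    ⟨Matrix.mem_unitaryGroup_iff'.2 hU, hdet⟩⟩, rfl, rfl⟩

/-- In a frame adapted to a common right eigenvector annihilated by a common left eigenvector,
matrices are upper triangular. -/
theorem exists_SU3_triangular {v w : Fin 3 → ℂ} (hv : v ≠ 0) (hw : w ≠ 0) (hwv : w ⬝ᵥ v = 0) :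
    ∃ U : SU3, ∀ M : Mat3, (∃ c : ℂ, M *ᵥ v = c • v) → (∃ d : ℂ, w ᵥ* M = d • w) →
      ∀ j k : Fin 3, j < k → ((U : Mat3)ᴴ * M * (U : Mat3)) k j = 0 := by
  obtain ⟨a, ha⟩ := exists_smul_star_dotProduct_eq_one hv
  -- The last column comes from `star w`, so that `w ⬝ᵥ v = 0` becomes Hermitian orthogonality of
  -- the two columns.
  obtain ⟨b, hb⟩ := exists_smul_star_dotProduct_eq_one (v := star w) (by simpa using hw)
  obtain ⟨U, hU0, hU2⟩ := exists_SU3_col ha hb (by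
    simp [star_smul, smul_dotProduct, dotProduct_smul, hwv])
  refine ⟨U, ?_⟩
  rintro M ⟨c, hc⟩ ⟨d, hd⟩ j k hjk
  have hUU := conjTranspose_mul_self U
  have hentry : ∀ i l, ((U : Mat3)ᴴ) i ⬝ᵥ (U : Mat3).col l = if i = l then 1 else 0 := by
    intro i l
    have := congrFun (congrFun hUU i) l
    rwa [Matrix.one_apply] at this
  have hMj : ((U : Mat3)ᴴ * M * (U : Mat3)) k j
      = ((U : Mat3)ᴴ) k ⬝ᵥ (M *ᵥ (U : Mat3).col j) := by
    rw [Matrix.mul_assoc]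
    rfl
  have hMj' : ((U : Mat3)ᴴ) k ⬝ᵥ (M *ᵥ (U : Mat3).col j)
      = (((U : Mat3)ᴴ) k ᵥ* M) ⬝ᵥ (U : Mat3).col j := Matrix.dotProduct_mulVec _ _ _
  -- A pair `j < k` in `Fin 3` has `j = 0` or `k = 2`: either the right eigenvector or the left one
  -- kills the entry.
  by_cases hj : j = 0
  · subst hj
    have h1 : M *ᵥ (U : Mat3).col 0 = c • (U : Mat3).col 0 := by
      rw [hU0, Matrix.mulVec_smul, hc, smul_comm]
    rw [hMj, h1, dotProduct_smul, hentry, if_neg hjk.ne', smul_zero]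
  · have hk : k = 2 := by fin_cases j <;> fin_cases k <;> simp_all
    subst hk
    have h0 : ((U : Mat3)ᴴ) 2 = star b • w := by
      have : ((U : Mat3)ᴴ) 2 = star ((U : Mat3).col 2) := rfl
      rw [this, hU2, star_smul, star_star]
    have h1 : ((U : Mat3)ᴴ) 2 ᵥ* M = d • ((U : Mat3)ᴴ) 2 := by
      rw [h0, Matrix.smul_vecMul, hd, smul_comm]
    rw [hMj, hMj', h1, smul_dotProduct, hentry, if_neg hjk.ne', smul_zero]

/-! ### The algebra of the group and the metric `B` -/

@[simp] theorem coe_bracket (X Y : su3) : (bracket X Y : Mat3) = X * Y - Y * X := rfl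

theorem B_apply (X Y : su3) : B X Y = -6 * ((X : Mat3) * (Y : Mat3)).trace.re := rfl

theorem B_comm (X Y : su3) : B X Y = B Y X := by
  rw [B_apply, B_apply, Matrix.trace_mul_comm]

theorem su3.conjTranspose (X : su3) : (X : Mat3)ᴴ = -X := X.2.1

theorem su3.trace (X : su3) : (X : Mat3).trace = 0 := X.2.2

/-- The trace form is real on `𝔰𝔲(3)`. -/
theorem trace_mul_eq_B (X Y : su3) : ((X : Mat3) * (Y : Mat3)).trace = ((-(B X Y) / 6 : ℝ) : ℂ) := by
  have h : star ((X : Mat3) * (Y : Mat3)).trace = ((X : Mat3) * (Y : Mat3)).trace := by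
    rw [← Matrix.trace_conjTranspose, Matrix.conjTranspose_mul, su3.conjTranspose,
      su3.conjTranspose, neg_mul_neg, Matrix.trace_mul_comm]
  rw [B_apply]
  have := Complex.conj_eq_iff_re.1 h
  rw [← this]
  push_cast
  simp

theorem B_self_eq (X : su3) : B X X = 6 * ∑ i, ∑ j, Complex.normSq ((X : Mat3) i j) := by
  have h : (X : Mat3) * X = -((X : Mat3) * (X : Mat3)ᴴ) := by
    rw [su3.conjTranspose, mul_neg, neg_neg]
  rw [B_apply, h, Matrix.trace_neg, Complex.neg_re, Matrix.trace, Complex.re_sum]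
  simp [Matrix.mul_apply, Complex.normSq_apply]

theorem B_pos {X : su3} (hX : X ≠ 0) : 0 < B X X := by
  rw [B_self_eq]
  have h : (X : Mat3) ≠ 0 := fun h => hX (Subtype.ext h)
  obtain ⟨i, hi⟩ := Function.ne_iff.1 h
  obtain ⟨j, hj⟩ := Function.ne_iff.1 hi
  have h1 : 0 < ∑ i, ∑ j, Complex.normSq ((X : Mat3) i j) :=
    Finset.sum_pos' (fun i _ => Finset.sum_nonneg fun j _ => Complex.normSq_nonneg _)
      ⟨i, Finset.mem_univ _, Finset.sum_pos' (fun j _ => Complex.normSq_nonneg _)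
        ⟨j, Finset.mem_univ _, Complex.normSq_pos.2 hj⟩⟩
  linarith

theorem eq_of_B_eq {X Y : su3} (h : ∀ Z, B X Z = B Y Z) : X = Y := by
  by_contra hne
  have h1 := B_pos (sub_ne_zero.2 hne)
  have h2 := h (X - Y)
  rw [map_sub B, LinearMap.sub_apply] at h1
  linarith

/-- A traceless matrix lies in the complexification of `𝔰𝔲(3)`. -/
theorem exists_add_I_smul {M : Mat3} (hM : M.trace = 0) :
    ∃ X Y : su3, (X : Mat3) + Complex.I • (Y : Mat3) = M := by
  have htr : Mᴴ.trace = 0 := by rw [Matrix.trace_conjTranspose, hM, star_zero]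
  refine ⟨⟨(1 / 2 : ℂ) • (M - Mᴴ), ?_, ?_⟩, ⟨(-Complex.I / 2) • (M + Mᴴ), ?_, ?_⟩, ?_⟩
  · rw [Matrix.conjTranspose_smul, Matrix.conjTranspose_sub, Matrix.conjTranspose_conjTranspose,
      ← smul_neg, neg_sub]
    simp
  · rw [Matrix.trace_smul, Matrix.trace_sub, hM, htr, sub_zero, smul_zero]
  · rw [Matrix.conjTranspose_smul, Matrix.conjTranspose_add, Matrix.conjTranspose_conjTranspose,
      ← neg_smul, add_comm]
    congr 1
    simp [neg_div]
  · rw [Matrix.trace_smul, Matrix.trace_add, hM, htr, add_zero, smul_zero]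
  · change (1 / 2 : ℂ) • (M - Mᴴ) + Complex.I • ((-Complex.I / 2) • (M + Mᴴ)) = M
    rw [smul_smul, show Complex.I * (-Complex.I / 2) = 1 / 2 by
      rw [mul_div_assoc', mul_neg, Complex.I_mul_I]; norm_num]
    ext i j
    simp only [Matrix.add_apply, Matrix.smul_apply, Matrix.sub_apply, smul_eq_mul]
    ring

/-! ### The `i`-eigenspace of `J` and the existence of an adapted frame -/

section LieTheory

attribute [local instance] LieRing.ofAssociativeRing

/-- The `i`-eigenspace of the complex-linear extension of `J`, where `J` satisfies the algebraic
integrability condition. -/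
def holomorphicSubalgebra (J : su3 →ₗ[ℝ] su3) (hJ : ∀ X, J (J X) = -X)
    (hN : ∀ X Y, bracket (J X) (J Y) - J (bracket (J X) Y) - J (bracket X (J Y))
      - bracket X Y = 0) : LieSubalgebra ℂ Mat3 where
  carrier := {M | ∃ X : su3, M = (X : Mat3) - Complex.I • (J X : Mat3)}
  add_mem' := by
    rintro _ _ ⟨X, rfl⟩ ⟨Y, rfl⟩
    refine ⟨X + Y, ?_⟩
    rw [map_add, Submodule.coe_add, Submodule.coe_add, smul_add]
    abel
  zero_mem' := ⟨0, by simp⟩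
  smul_mem' := by
    rintro c _ ⟨X, rfl⟩
    -- Multiplying `X - iJX` by `i` amounts to replacing `X` by `J X`.
    refine ⟨c.re • X + c.im • J X, ?_⟩
    rw [map_add, map_smul, map_smul, hJ]
    ext i j
    simp only [Matrix.smul_apply, Matrix.sub_apply, Matrix.add_apply, Submodule.coe_add,
      Submodule.coe_smul, Submodule.coe_neg, Matrix.neg_apply, smul_eq_mul, Complex.real_smul]
    conv_lhs => rw [← Complex.re_add_im c]
    linear_combination (-(c.im : ℂ) * (J X : Mat3) i j) * Complex.I_mul_I
  lie_mem' := by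
    rintro _ _ ⟨X, rfl⟩ ⟨Y, rfl⟩
    -- This is the `𝔰𝔲(3)`-part of the commutator; integrability says that `J` maps it to `[JX,Y] +
    -- [X,JY]`, which matches the other part.
    refine ⟨bracket X Y - bracket (J X) (J Y), ?_⟩
    have h : J (bracket X Y - bracket (J X) (J Y)) = bracket (J X) Y + bracket X (J Y) := by
      have h1 : bracket X Y - bracket (J X) (J Y) = -J (bracket (J X) Y + bracket X (J Y)) := by
        rw [map_add, ← sub_eq_zero, ← neg_eq_zero, ← hN X Y]
        abel
      rw [h1, map_neg, hJ, neg_neg]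
    rw [h, LieRing.of_associative_ring_bracket]
    simp only [Submodule.coe_sub, Submodule.coe_add, coe_bracket, sub_mul, mul_sub,
      smul_mul_assoc, mul_smul_comm, smul_smul, Complex.I_mul_I, smul_add, smul_sub]
    simp only [neg_smul, one_smul]
    abel

end LieTheory

theorem fieldBracket_const (X Y : su3) (p : SU3) :
    fieldBracket (fun _ => X) (fun _ => Y) p = bracket X Y := by
  simp [fieldBracket, fieldDeriv]

theorem isSmooth_const {V : Type*} [NormedAddCommGroup V] [NormedSpace ℝ V] (v : V) :
    IsSmooth (fun _ : SU3 => v) := ⟨fun _ => v, contDiff_const, fun _ => rfl⟩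

/-- Integrability in terms of the Lie algebra. -/
theorem IsInvariantComplexStructure.bracket {J : su3 →ₗ[ℝ] su3}
    (hJ : IsInvariantComplexStructure J) (X Y : su3) :
    bracket (J X) (J Y) - J (bracket (J X) Y) - J (bracket X (J Y)) - bracket X Y = 0 := by
  have h := hJ.nijenhuis (fun _ => X) (fun _ => Y) (isSmooth_const X) (isSmooth_const Y) 1
  simpa only [fieldBracket_const] using h

theorem map_left_eq_neg {J : su3 →ₗ[ℝ] su3} {g : su3 →ₗ[ℝ] su3 →ₗ[ℝ] ℝ}
    (hJ : ∀ X, J (J X) = -X) (hg : ∀ X Y, g (J X) (J Y) = g X Y) (X Y : su3) :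
    g (J X) Y = -g X (J Y) := by
  have h := hg X (J Y)
  rw [hJ, map_neg] at h
  linarith

/-- A `B`-orthogonal integrable left-invariant complex structure has an adapted frame. -/
theorem IsInvariantComplexStructure.exists_isAdapted {J : su3 →ₗ[ℝ] su3}
    (hJ : IsInvariantComplexStructure J) (hB : ∀ X Y, B (J X) (J Y) = B X Y) :
    ∃ U : SU3, IsAdapted J U := by
  have hsq := hJ.sq_eq_neg
  obtain ⟨v, w, hv, hw, hwv, H⟩ :=
    (holomorphicSubalgebra J hsq hJ.bracket).exists_flag (by
      rintro _ ⟨X, rfl⟩ _ ⟨Y, rfl⟩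
      simp only [sub_mul, mul_sub, smul_mul_assoc, mul_smul_comm, Matrix.trace_sub,
        Matrix.trace_smul, trace_mul_eq_B, smul_eq_mul, hB, map_left_eq_neg hsq hB]
      push_cast
      linear_combination (-(B X Y) / 6 : ℂ) * Complex.I_mul_I)
  obtain ⟨U, hU⟩ := exists_SU3_triangular hv hw hwv
  refine ⟨U, fun j k hjk => ?_⟩
  have htr : ∀ M : Mat3, ((U : Mat3) * Matrix.single j k 1 * (U : Mat3)ᴴ * M).trace
      = ((U : Mat3)ᴴ * M * (U : Mat3)) k j := by
    intro M
    rw [Matrix.mul_assoc, Matrix.mul_assoc, Matrix.trace_mul_comm, Matrix.mul_assoc,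
      Matrix.trace_single_mul, one_smul]
  have h0 : ((U : Mat3) * Matrix.single j k 1 * (U : Mat3)ᴴ).trace = 0 := by
    have := htr 1
    rw [Matrix.mul_one, Matrix.mul_one, conjTranspose_mul_self,
      Matrix.one_apply_ne hjk.ne'] at this
    exact this
  obtain ⟨P, R, hPR⟩ := exists_add_I_smul h0
  -- `P + iR` is trace-orthogonal to every `X - iJX`. The real part of this reads `B(P,X) = -B(R,JX)
  -- = B(JR,X)`.
  have hPJ : P = J R := by
    apply eq_of_B_eq
    intro X
    have h1 := htr ((X : Mat3) - Complex.I • (J X : Mat3))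
    rw [hU _ (H _ ⟨X, rfl⟩).1 (H _ ⟨X, rfl⟩).2 j k hjk, ← hPR] at h1
    simp only [add_mul, mul_sub, smul_mul_assoc, mul_smul_comm, Matrix.trace_sub,
      Matrix.trace_add, Matrix.trace_smul, trace_mul_eq_B, smul_eq_mul] at h1
    have h2 := congrArg Complex.re h1
    simp only [Complex.add_re, Complex.sub_re, Complex.mul_re, Complex.ofReal_re,
      Complex.ofReal_im, Complex.I_re, Complex.I_im, Complex.zero_re, Complex.mul_im,
      Complex.add_im] at h2
    rw [map_left_eq_neg hsq hB]
    linarith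
  refine ⟨P, R, hPR, ?_⟩
  rw [hPJ, hsq, smul_add, smul_smul, Complex.I_mul_I, Submodule.coe_neg]
  simp [add_comm]

end SU3Geometry

namespace SU3Geometry

/-! ### Calculus on the group -/

section Calculus

variable {V W V' : Type*} [NormedAddCommGroup V] [NormedSpace ℝ V]
  [NormedAddCommGroup W] [NormedSpace ℝ W] [NormedAddCommGroup V'] [NormedSpace ℝ V']

section Exp

attribute [local instance] Matrix.linftyOpNormedRing Matrix.linftyOpNormedAlgebra

theorem hasDerivAt_mul_exp_smul (P A : Mat3) :
    HasDerivAt (fun t : ℝ => P * NormedSpace.exp (t • A)) (P * A) 0 := by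
  have h := (hasDerivAt_exp_smul_const (𝕂 := ℝ) A (0 : ℝ)).const_mul P
  rw [zero_smul, NormedSpace.exp_zero, one_mul] at h
  exact h

theorem contDiff_mat_mul {n : WithTop ℕ∞} {F G : V → Mat3} (hF : ContDiff ℝ n F)
    (hG : ContDiff ℝ n G) : ContDiff ℝ n (fun x => F x * G x) := hF.mul hG

end Exp

/-- The derivative along a field is the Fréchet derivative of any smooth extension in the direction
`p · A`. Linearity in the field and smoothness of the result follow from this formula. -/
theorem hasDerivAt_along {F : Mat3 → V} {f : SU3 → V} (hF : Differentiable ℝ F)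
    (hf : ∀ p : SU3, F (p : Mat3) = f p) (A : su3) (p : SU3) :
    HasDerivAt (fun t : ℝ => f (p * expSU3 (t • A))) (fderiv ℝ F (p : Mat3) ((p : Mat3) * A)) 0 := by
  have h1 : HasDerivAt (fun t : ℝ => (p : Mat3) * NormedSpace.exp (t • (A : Mat3)))
      ((p : Mat3) * A) 0 := hasDerivAt_mul_exp_smul _ _
  have h0 : (p : Mat3) * NormedSpace.exp ((0 : ℝ) • (A : Mat3)) = p := by
    rw [zero_smul, NormedSpace.exp_zero, mul_one]
  have h2 : HasFDerivAt F (fderiv ℝ F (p : Mat3))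
      ((p : Mat3) * NormedSpace.exp ((0 : ℝ) • (A : Mat3))) := by
    rw [h0]
    exact (hF _).hasFDerivAt
  have h3 := h2.comp_hasDerivAt (0 : ℝ) h1
  refine h3.congr_of_eventuallyEq (Filter.Eventually.of_forall fun t => ?_)
  exact (hf _).symm

theorem IsSmooth.hasDerivAt {f : SU3 → V} (hf : IsSmooth f) (X : SU3 → su3) (p : SU3) :
    HasDerivAt (fun t : ℝ => f (p * expSU3 (t • X p))) (fieldDeriv X f p) 0 := by
  obtain ⟨F, hF, hFf⟩ := hf
  have h := hasDerivAt_along (hF.differentiable (by simp)) hFf (X p) p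
  rw [fieldDeriv, h.deriv]
  exact h

theorem fieldDeriv_eq_fderiv {F : Mat3 → V} {f : SU3 → V} (hF : ContDiff ℝ ∞ F)
    (hf : ∀ p : SU3, F (p : Mat3) = f p) (X : SU3 → su3) (p : SU3) :
    fieldDeriv X f p = fderiv ℝ F (p : Mat3) ((p : Mat3) * X p) :=
  (hasDerivAt_along (hF.differentiable (by simp)) hf (X p) p).deriv

theorem mul_exp_zero (p : SU3) (A : su3) : p * expSU3 ((0 : ℝ) • A) = p := by
  apply Subtype.ext
  change (p : Mat3) * NormedSpace.exp (((0 : ℝ) • A : su3) : Mat3) = p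
  rw [zero_smul, Submodule.coe_zero, NormedSpace.exp_zero, mul_one]

theorem fieldDeriv_const (X : SU3 → su3) (v : V) (p : SU3) :
    fieldDeriv X (fun _ => v) p = 0 := by simp [fieldDeriv]

theorem fieldDeriv_add_left {f : SU3 → V} (hf : IsSmooth f) (X Y : SU3 → su3) (p : SU3) :
    fieldDeriv (X + Y) f p = fieldDeriv X f p + fieldDeriv Y f p := by
  obtain ⟨F, hF, hFf⟩ := hf
  simp only [fieldDeriv_eq_fderiv hF hFf, Pi.add_apply, Submodule.coe_add, mul_add, map_add]

theorem fieldDeriv_smul_left {f : SU3 → V} (hf : IsSmooth f) (c : SU3 → ℝ) (X : SU3 → su3)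
    (p : SU3) : fieldDeriv (fun q => c q • X q) f p = c p • fieldDeriv X f p := by
  obtain ⟨F, hF, hFf⟩ := hf
  simp only [fieldDeriv_eq_fderiv hF hFf, Submodule.coe_smul, mul_smul_comm, map_smul]

theorem fieldDeriv_add {f g : SU3 → V} (hf : IsSmooth f) (hg : IsSmooth g) (X : SU3 → su3)
    (p : SU3) : fieldDeriv X (f + g) p = fieldDeriv X f p + fieldDeriv X g p :=
  ((hf.hasDerivAt X p).add (hg.hasDerivAt X p)).deriv

theorem fieldDeriv_smul {c : SU3 → ℝ} {f : SU3 → V} (hc : IsSmooth c) (hf : IsSmooth f)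
    (X : SU3 → su3) (p : SU3) :
    fieldDeriv X (fun q => c q • f q) p = fieldDeriv X c p • f p + c p • fieldDeriv X f p := by
  have h := ((hc.hasDerivAt X p).smul (hf.hasDerivAt X p)).deriv
  rw [mul_exp_zero] at h
  rw [add_comm]
  exact h

theorem fieldDeriv_clm (L : V →L[ℝ] W) {f : SU3 → V} (hf : IsSmooth f) (X : SU3 → su3) (p : SU3) :
    fieldDeriv X (fun q => L (f q)) p = L (fieldDeriv X f p) :=
  (L.hasFDerivAt.comp_hasDerivAt _ (hf.hasDerivAt X p)).deriv

theorem fieldDeriv_bilin (L : V →L[ℝ] W →L[ℝ] V') {f : SU3 → V} {g : SU3 → W} (hf : IsSmooth f)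
    (hg : IsSmooth g) (X : SU3 → su3) (p : SU3) :
    fieldDeriv X (fun q => L (f q) (g q)) p
      = L (fieldDeriv X f p) (g p) + L (f p) (fieldDeriv X g p) := by
  have h := (L.hasFDerivAt.comp_hasDerivAt _ (hf.hasDerivAt X p)).clm_apply (hg.hasDerivAt X p)
  have h := h.deriv
  simp only [Function.comp_apply, mul_exp_zero] at h
  exact h

theorem isSmooth_bilin (L : V →L[ℝ] W →L[ℝ] V') {f : SU3 → V} {g : SU3 → W} (hf : IsSmooth f)
    (hg : IsSmooth g) : IsSmooth (fun q => L (f q) (g q)) := by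
  obtain ⟨F, hF, hFf⟩ := hf
  obtain ⟨G, hG, hGg⟩ := hg
  exact ⟨fun M => L (F M) (G M), (L.contDiff.comp hF).clm_apply hG, fun p => by
    simp only [hFf, hGg]⟩

theorem IsSmooth.add {f g : SU3 → V} (hf : IsSmooth f) (hg : IsSmooth g) :
    IsSmooth (fun p => f p + g p) := by
  obtain ⟨F, hF, hFf⟩ := hf
  obtain ⟨G, hG, hGg⟩ := hg
  exact ⟨fun M => F M + G M, hF.add hG, fun p => by simp only [hFf, hGg]⟩

theorem IsSmooth.fieldDeriv {f : SU3 → V} {X : SU3 → su3} (hX : IsSmooth X) (hf : IsSmooth f) :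
    IsSmooth (fieldDeriv X f) := by
  obtain ⟨F, hF, hFf⟩ := hf
  obtain ⟨G, hG, hGX⟩ := hX
  refine ⟨fun M => fderiv ℝ F M (M * (G M : Mat3)), ?_, fun p => ?_⟩
  · refine (hF.fderiv_right (m := ∞) (by simp)).clm_apply (contDiff_mat_mul contDiff_id ?_)
    exact su3.subtypeL.contDiff.comp hG
  · simp only [fieldDeriv_eq_fderiv hF hFf, hGX]

end Calculus

end SU3Geometry

noncomputable section

namespace SU3Geometry

/-! ### Trace identities for endomorphisms commuting with `J` or squaring to `-1` -/

section Trace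

variable {R M : Type*} [CommRing R] [AddCommGroup M] [Module R M]

/-- `tr(JQP) = tr(QJP) = tr(JPQ)`, so commutation with `Q` alone suffices. This eliminates `[Γ X, Γ
Y]` from the Ricci form. -/
theorem trace_mul_commutator_sub {J P Q S : Module.End R M} (hQ : J * Q = Q * J) :
    LinearMap.trace R M (J * (P * Q - Q * P - S)) = -LinearMap.trace R M (J * S) := by
  have h : LinearMap.trace R M (J * (Q * P)) = LinearMap.trace R M (J * (P * Q)) := by
    rw [← mul_assoc, hQ, mul_assoc, LinearMap.trace_mul_comm, mul_assoc]
  rw [mul_sub, mul_sub, map_sub, map_sub, h, sub_self, zero_sub]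

theorem trace_mul_mul_of_mul_self {J A : Module.End R M} (hJ : J * J = -1) :
    LinearMap.trace R M (J * A * J) = -LinearMap.trace R M A := by
  rw [LinearMap.trace_mul_comm, ← mul_assoc, hJ, neg_one_mul, map_neg]

end Trace

/-! ### The adjoint representation of the Lie algebra -/

/-- The adjoint representation of `𝔰𝔲(3)`. -/
def adₗ : su3 →ₗ[ℝ] su3 →ₗ[ℝ] su3 :=
  LinearMap.mk₂ ℝ bracket
    (by intro X X' Y; apply Subtype.ext; simp [add_mul, mul_add]; abel)
    (by intro c X Y; apply Subtype.ext; simp [smul_sub])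
    (by intro X Y Y'; apply Subtype.ext; simp [add_mul, mul_add]; abel)
    (by intro c X Y; apply Subtype.ext; simp [smul_sub])

@[simp] theorem adₗ_apply (X Y : su3) : adₗ X Y = bracket X Y := rfl

theorem bracket_comm (X Y : su3) : bracket X Y = -bracket Y X := by
  apply Subtype.ext
  simp

theorem bracket_neg_left (X Y : su3) : bracket (-X) Y = -bracket X Y := by
  rw [← adₗ_apply, map_neg, LinearMap.neg_apply, adₗ_apply]

theorem bracket_neg_right (X Y : su3) : bracket X (-Y) = -bracket X Y := by
  rw [← adₗ_apply, map_neg, adₗ_apply]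

theorem B_bracket (X Y Z : su3) : B (bracket X Y) Z = B X (bracket Y Z) := by
  simp only [B_apply, coe_bracket, sub_mul, mul_sub, Matrix.trace_sub, Matrix.mul_assoc]
  rw [Matrix.trace_mul_comm (X : Mat3) ((Z : Mat3) * Y), Matrix.mul_assoc]
  rw [Matrix.trace_mul_comm (Z : Mat3), Matrix.mul_assoc]

/-! ### Orthonormal bases and traces -/

theorem exists_orthonormal_basis {g : su3 →ₗ[ℝ] su3 →ₗ[ℝ] ℝ} (hs : ∀ X Y, g X Y = g Y X)
    (hp : ∀ X, X ≠ 0 → 0 < g X X) :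
    ∃ E : Module.Basis (Fin (Module.finrank ℝ su3)) ℝ su3,
      ∀ i j, g (E i) (E j) = if i = j then 1 else 0 := by
  have : Invertible (2 : ℝ) := invertibleOfNonzero two_ne_zero
  obtain ⟨v, hv⟩ := LinearMap.BilinForm.exists_orthogonal_basis (B := g) ⟨hs⟩
  have hpos : ∀ i, 0 < g (v i) (v i) := fun i => hp _ (v.ne_zero i)
  have hne : ∀ i, (Real.sqrt (g (v i) (v i)))⁻¹ ≠ 0 := fun i =>
    inv_ne_zero (Real.sqrt_pos.2 (hpos i)).ne'
  refine ⟨v.unitsSMul fun i => Units.mk0 _ (hne i), fun i j => ?_⟩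
  simp only [Module.Basis.unitsSMul_apply, Units.smul_mk0, map_smul, LinearMap.smul_apply,
    smul_eq_mul]
  split_ifs with h
  · subst h
    nth_rewrite 3 [← Real.mul_self_sqrt (hpos i).le]
    have := (Real.sqrt_pos.2 (hpos i)).ne'
    field_simp
  · rw [show g (v i) (v j) = 0 from hv h, mul_zero, mul_zero]

section Orthonormal

variable {ι : Type*} [Fintype ι] [DecidableEq ι] {g : su3 →ₗ[ℝ] su3 →ₗ[ℝ] ℝ}
  {E : Module.Basis ι ℝ su3} (hE : ∀ i j, g (E i) (E j) = if i = j then 1 else 0)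

include hE

theorem repr_eq_of_orthonormal (X : su3) (i : ι) : E.repr X i = g X (E i) := by
  conv_rhs => rw [← E.sum_repr X]
  simp only [map_sum, map_smul, LinearMap.sum_apply, LinearMap.smul_apply, smul_eq_mul, hE,
    mul_ite, mul_one, mul_zero, Finset.sum_ite_eq', Finset.mem_univ, if_true]

theorem trace_eq_of_orthonormal (f : su3 →ₗ[ℝ] su3) :
    LinearMap.trace ℝ su3 f = ∑ i, g (f (E i)) (E i) := by
  rw [LinearMap.trace_eq_matrix_trace ℝ E, Matrix.trace]
  simp only [Matrix.diag_apply, LinearMap.toMatrix_apply, repr_eq_of_orthonormal hE]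

end Orthonormal

/-- Unimodularity: `ad X` is skew for `B`. -/
theorem trace_adₗ (X : su3) : LinearMap.trace ℝ su3 (adₗ X) = 0 := by
  obtain ⟨E, hE⟩ := exists_orthonormal_basis B_comm fun X => B_pos
  rw [trace_eq_of_orthonormal hE]
  refine Finset.sum_eq_zero fun i _ => ?_
  rw [adₗ_apply, B_bracket, bracket]
  simp [B_apply]

theorem eq_of_metric_eq {g : su3 →ₗ[ℝ] su3 →ₗ[ℝ] ℝ} (hp : ∀ X, X ≠ 0 → 0 < g X X) {X Y : su3}
    (h : ∀ Z, g X Z = g Y Z) : X = Y := by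
  by_contra hne
  have h1 := hp _ (sub_ne_zero.2 hne)
  rw [map_sub g, LinearMap.sub_apply, h, sub_self] at h1
  exact lt_irrefl _ h1

/-! ### The Bismut connection of a left-invariant Hermitian metric -/

/-- The form `g(∇_X Y, Z)` of the Bismut connection on left-invariant fields. -/
def bismutForm (J : su3 →ₗ[ℝ] su3) (g : su3 →ₗ[ℝ] su3 →ₗ[ℝ] ℝ) (X Y Z : su3) : ℝ :=
  (g (bracket X Y) Z - g (bracket Y Z) X + g (bracket Z X) Y - g (bracket (J X) (J Y)) Z
    - g (bracket (J Y) (J Z)) X - g (bracket (J Z) (J X)) Y) / 2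

/-- In `bismutForm` the first three terms are Koszul's formula for the Levi-Civita connection. The
last three are half the torsion form `dω(J·,J·,J·)`, with `ω = g(J·,·)`. The product `Γ` is its
Riesz representative for `g`. -/
theorem exists_bismutProduct {J : su3 →ₗ[ℝ] su3} {g : su3 →ₗ[ℝ] su3 →ₗ[ℝ] ℝ}
    (hg : IsInvariantHermitianMetric J g) :
    ∃ Γ : su3 →ₗ[ℝ] su3 →ₗ[ℝ] su3, ∀ X Y Z, g (Γ X Y) Z = bismutForm J g X Y Z := by
  obtain ⟨E, hE⟩ := exists_orthonormal_basis hg.symm hg.pos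
  have hK : ∃ K : su3 →ₗ[ℝ] su3 →ₗ[ℝ] su3 →ₗ[ℝ] ℝ, ∀ X Y Z, K X Y Z = bismutForm J g X Y Z := by
    refine ⟨LinearMap.mk₂ ℝ (fun X Y =>
      ({ toFun := bismutForm J g X Y, map_add' := ?_, map_smul' := ?_ } : su3 →ₗ[ℝ] ℝ))
      ?_ ?_ ?_ ?_, fun X Y Z => rfl⟩
    all_goals
      intros
      try ext Z
      simp only [bismutForm, ← adₗ_apply, map_add, map_smul, LinearMap.add_apply,
        LinearMap.smul_apply, smul_eq_mul, LinearMap.coe_mk, AddHom.coe_mk, RingHom.id_apply]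
      ring
  obtain ⟨K, hK⟩ := hK
  let S : (su3 →ₗ[ℝ] ℝ) →ₗ[ℝ] su3 :=
    ∑ i, (LinearMap.toSpanSingleton ℝ su3 (E i)).comp (LinearMap.applyₗ (E i))
  have hS : ∀ φ Z, g (S φ) Z = φ Z := by
    intro φ Z
    have h1 : S φ = ∑ i, φ (E i) • E i := by simp [S]
    rw [h1]
    conv_rhs => rw [← E.sum_repr Z]
    simp only [map_sum, map_smul, LinearMap.sum_apply, LinearMap.smul_apply, smul_eq_mul,
      repr_eq_of_orthonormal hE]
    exact Finset.sum_congr rfl fun i _ => by rw [hg.symm Z, mul_comm]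
  exact ⟨K.compr₂ S, fun X Y Z => by rw [LinearMap.compr₂_apply, hS, hK]⟩

section Bismut

variable {J : su3 →ₗ[ℝ] su3} {g : su3 →ₗ[ℝ] su3 →ₗ[ℝ] ℝ} {Γ : su3 →ₗ[ℝ] su3 →ₗ[ℝ] su3}

theorem metric_bracket_comm (X Y Z : su3) : g (bracket X Y) Z = -g (bracket Y X) Z := by
  rw [bracket_comm, map_neg, LinearMap.neg_apply]

theorem bismutForm_skew (X Y Z : su3) : bismutForm J g X Y Z = -bismutForm J g X Z Y := by
  have h1 := metric_bracket_comm (g := g) X Z Y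
  have h2 := metric_bracket_comm (g := g) Z Y X
  have h3 := metric_bracket_comm (g := g) Y X Z
  have h4 := metric_bracket_comm (g := g) (J X) (J Z) Y
  have h5 := metric_bracket_comm (g := g) (J Z) (J Y) X
  have h6 := metric_bracket_comm (g := g) (J Y) (J X) Z
  unfold bismutForm
  linarith

/-- The identity is the vanishing of the Nijenhuis tensor, paired with `g`, at the arguments `(X,
Y)` and `(Z, X)`. -/
theorem bismutForm_complex (hJ : IsInvariantComplexStructure J)
    (hg : IsInvariantHermitianMetric J g) (X Y Z : su3) :
    bismutForm J g X (J Y) Z + bismutForm J g X Y (J Z) = 0 := by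
  have hN : ∀ X Y Z, g (bracket (J X) (J Y)) (J Z) - g (bracket X Y) (J Z)
      = g (bracket (J X) Y) Z + g (bracket X (J Y)) Z := by
    intro X Y Z
    have h := congrArg (fun W => g W (J Z)) (hJ.bracket X Y)
    simp only [map_sub, LinearMap.sub_apply, map_zero, LinearMap.zero_apply, hg.hermitian] at h
    linarith
  have h1 := hN X Y Z
  have h2 := hN Z X Y
  simp only [bismutForm, hJ.sq_eq_neg, bracket_neg_left, bracket_neg_right, map_neg,
    LinearMap.neg_apply]
  linarith

theorem bismut_complex (hJ : IsInvariantComplexStructure J)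
    (hg : IsInvariantHermitianMetric J g) (hΓ : ∀ X Y Z, g (Γ X Y) Z = bismutForm J g X Y Z)
    (X Y : su3) : Γ X (J Y) = J (Γ X Y) := by
  refine eq_of_metric_eq hg.pos fun Z => ?_
  have h := bismutForm_complex hJ hg X Y Z
  rw [map_left_eq_neg hJ.sq_eq_neg hg.hermitian, hΓ, hΓ]
  linarith

/-- The connection that is given by a bilinear product on left-invariant fields. -/
def productConnection (Γ : su3 →ₗ[ℝ] su3 →ₗ[ℝ] su3) (X Y : SU3 → su3) (p : SU3) : su3 :=
  fieldDeriv X Y p + Γ (X p) (Y p)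

theorem isConnection_productConnection (Γ : su3 →ₗ[ℝ] su3 →ₗ[ℝ] su3) :
    IsConnection (productConnection Γ) where
  smooth X Y hX hY := (hX.fieldDeriv hY).add (isSmooth_bilin Γ.toContinuousBilinearMap hX hY)
  add_left X X' Y _ _ hY := by
    funext p
    simp only [productConnection, fieldDeriv_add_left hY, Pi.add_apply, map_add,
      LinearMap.add_apply]
    abel
  smul_left f X Y _ _ hY := by
    funext p
    simp only [productConnection, fieldDeriv_smul_left hY, map_smul, LinearMap.smul_apply,
      smul_add]
  add_right X Y Y' _ hY hY' := by
    funext p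
    simp only [productConnection, fieldDeriv_add hY hY', Pi.add_apply, map_add]
    abel
  leibniz f X Y hf _ hY := by
    funext p
    simp only [productConnection, fieldDeriv_smul hf hY, map_smul, smul_add, add_assoc]

theorem isBismutConnection_productConnection (hJ : IsInvariantComplexStructure J)
    (hg : IsInvariantHermitianMetric J g) (hΓ : ∀ X Y Z, g (Γ X Y) Z = bismutForm J g X Y Z) :
    IsBismutConnection J g (productConnection Γ) where
  toIsConnection := isConnection_productConnection Γ
  metric X Y Z _ hY hZ p := by
    have h : fieldDeriv X (fun q => g (Y q) (Z q)) p
        = g (fieldDeriv X Y p) (Z p) + g (Y p) (fieldDeriv X Z p) :=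
      fieldDeriv_bilin g.toContinuousBilinearMap hY hZ X p
    have h2 := bismutForm_skew (J := J) (g := g) (X p) (Y p) (Z p)
    rw [h]
    simp only [productConnection, map_add, LinearMap.add_apply, hΓ, hg.symm (Y p) (Γ _ _)]
    linarith
  complex X Y _ hY p := by
    have h := fieldDeriv_clm (LinearMap.toContinuousLinearMap J) hY X p
    simp only [LinearMap.coe_toContinuousLinearMap'] at h
    simp only [productConnection, h, bismut_complex hJ hg hΓ, map_add]
  skew X Y Z _ _ _ p := by
    have ht : ∀ X Y, torsion (productConnection Γ) X Y p
        = Γ (X p) (Y p) - Γ (Y p) (X p) - bracket (X p) (Y p) := by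
      intro X Y
      simp only [torsion, productConnection, fieldBracket]
      abel
    simp only [ht, map_sub, LinearMap.sub_apply, hΓ, bismutForm]
    have h1 := metric_bracket_comm (g := g) (X p) (Z p) (Y p)
    have h2 := metric_bracket_comm (g := g) (Z p) (Y p) (X p)
    have h3 := metric_bracket_comm (g := g) (Y p) (X p) (Z p)
    have h4 := metric_bracket_comm (g := g) (J (X p)) (J (Z p)) (Y p)
    have h5 := metric_bracket_comm (g := g) (J (Z p)) (J (Y p)) (X p)
    have h6 := metric_bracket_comm (g := g) (J (Y p)) (J (X p)) (Z p)
    linarith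

/-- A Hermitian product on the Lie algebra whose torsion is skew-symmetric is determined. -/
theorem product_unique (hJ : ∀ X, J (J X) = -X) (hg : IsInvariantHermitianMetric J g)
    {Γ Γ' : su3 → su3 → su3}
    (hm : ∀ X Y Z, g (Γ X Y) Z + g Y (Γ X Z) = 0)
    (hc : ∀ X Y, Γ X (J Y) = J (Γ X Y))
    (hs : ∀ X Y Z, g (Γ X Y - Γ Y X - bracket X Y) Z = -g (Γ X Z - Γ Z X - bracket X Z) Y)
    (hm' : ∀ X Y Z, g (Γ' X Y) Z + g Y (Γ' X Z) = 0)
    (hc' : ∀ X Y, Γ' X (J Y) = J (Γ' X Y))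
    (hs' : ∀ X Y Z, g (Γ' X Y - Γ' Y X - bracket X Y) Z = -g (Γ' X Z - Γ' Z X - bracket X Z) Y)
    (X Y : su3) : Γ X Y = Γ' X Y := by
  -- The difference of the products is a 3-form: skew in the last two slots because both preserve
  -- `g`, and in the outer slots because both torsions are skew.
  set δ : su3 → su3 → su3 → ℝ := fun X Y Z => g (Γ X Y) Z - g (Γ' X Y) Z with hδ
  have h1 : ∀ X Y Z, δ X Y Z = -δ X Z Y := by
    intro X Y Z
    have a := hm X Y Z
    have a' := hm' X Y Z
    rw [hg.symm Y] at a a'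
    simp only [hδ]
    linarith
  have h2 : ∀ X Y Z, δ X Y Z = -δ Z Y X := by
    intro X Y Z
    have a := hs Y X Z
    have a' := hs' Y X Z
    have b := h1 Y X Z
    simp only [hδ] at b ⊢
    simp only [map_sub, LinearMap.sub_apply] at a a'
    linarith
  have h3 : ∀ X Y Z, δ X (J Y) Z = -δ X Y (J Z) := by
    intro X Y Z
    simp only [hδ, hc, hc', map_left_eq_neg hJ hg.hermitian]
    ring
  -- Moving `J` from one slot to another changes the sign. Three moves return `J` to its slot with
  -- sign `-1`.
  have h4 : ∀ X Y Z, δ X Y (J Z) = 0 := by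
    intro X Y Z
    have e1 : δ X Y (J Z) = -δ (J X) Y Z := by
      have a := h3 Y Z X
      have b := h1 Y (J Z) X
      have c := h1 Y Z (J X)
      have d := h2 Y X (J Z)
      have d1 := h1 X Y (J Z)
      have d2 := h2 X (J Z) Y
      have d3 := h1 Y (J Z) X
      have f1 := h1 (J X) Y Z
      have f2 := h2 (J X) Z Y
      linarith
    have e2 : δ (J X) Y Z = -δ X (J Y) Z := by
      have a := h3 Z X Y
      have b1 := h2 (J X) Y Z
      have b2 := h1 Z Y (J X)
      have c1 := h2 X (J Y) Z
      have c2 := h1 Z (J Y) X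
      linarith
    have e3 := h3 X Y Z
    linarith
  refine eq_of_metric_eq hg.pos fun Z => ?_
  have h5 := h4 X Y (-J Z)
  rw [map_neg, hJ, neg_neg] at h5
  exact sub_eq_zero.1 h5

/-- On constant fields the derivative terms vanish and the axioms become the hypotheses of
`product_unique`. Constant fields are enough for the necessity of the CYT condition. -/
theorem IsBismutConnection.eq_product {D : (SU3 → su3) → (SU3 → su3) → SU3 → su3}
    (hD : IsBismutConnection J g D) (hJ : IsInvariantComplexStructure J)
    (hg : IsInvariantHermitianMetric J g) (hΓ : ∀ X Y Z, g (Γ X Y) Z = bismutForm J g X Y Z)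
    (X Y : su3) : D (fun _ => X) (fun _ => Y) = fun _ => Γ X Y := by
  have aux : ∀ {D : (SU3 → su3) → (SU3 → su3) → SU3 → su3}, IsBismutConnection J g D → ∀ p,
      (∀ X Y Z, g (D (fun _ => X) (fun _ => Y) p) Z + g Y (D (fun _ => X) (fun _ => Z) p) = 0) ∧
      (∀ X Y, D (fun _ => X) (fun _ => J Y) p = J (D (fun _ => X) (fun _ => Y) p)) ∧
      (∀ X Y Z, g (D (fun _ => X) (fun _ => Y) p - D (fun _ => Y) (fun _ => X) p - bracket X Y) Z
        = -g (D (fun _ => X) (fun _ => Z) p - D (fun _ => Z) (fun _ => X) p - bracket X Z) Y) := by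
    intro D hD p
    refine ⟨fun X Y Z => ?_, fun X Y => ?_, fun X Y Z => ?_⟩
    · have h := hD.metric _ _ _ (isSmooth_const X) (isSmooth_const Y) (isSmooth_const Z) p
      rw [fieldDeriv_const] at h
      exact h.symm
    · exact hD.complex _ _ (isSmooth_const X) (isSmooth_const Y) p
    · have h := hD.skew _ _ _ (isSmooth_const X) (isSmooth_const Y) (isSmooth_const Z) p
      simpa only [torsion, fieldBracket_const] using h
  funext p
  obtain ⟨a, b, c⟩ := aux hD p
  obtain ⟨a', b', c'⟩ := aux (isBismutConnection_productConnection hJ hg hΓ) p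
  have h := product_unique (Γ := fun X Y => D (fun _ => X) (fun _ => Y) p)
    (Γ' := fun X Y => productConnection Γ (fun _ => X) (fun _ => Y) p)
    hJ.sq_eq_neg hg a b c a' b' c' X Y
  simpa [productConnection, fieldDeriv_const] using h

/-! ### The Ricci form -/

/-- The curvature of a left-invariant connection. -/
def productCurvature (Γ : su3 →ₗ[ℝ] su3 →ₗ[ℝ] su3) (X Y : su3) : su3 →ₗ[ℝ] su3 :=
  Γ X ∘ₗ Γ Y - Γ Y ∘ₗ Γ X - Γ (bracket X Y)

theorem curvature_productConnection {X Y : SU3 → su3} (hX : IsSmooth X) (hY : IsSmooth Y)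
    (Z : su3) (p : SU3) : curvature (productConnection Γ) X Y (fun _ => Z) p
      = productCurvature Γ (X p) (Y p) Z := by
  have h1 : ∀ W : SU3 → su3, productConnection Γ W (fun _ => Z) = fun q => Γ (W q) Z := by
    intro W
    funext q
    rw [productConnection, fieldDeriv_const, zero_add]
  have h2 : ∀ V W : SU3 → su3, IsSmooth W → fieldDeriv V (fun q => Γ (W q) Z) p
      = Γ (fieldDeriv V W p) Z := fun V W hW =>
    fieldDeriv_clm (LinearMap.toContinuousLinearMap (Γ.flip Z)) hW V p
  simp only [curvature, h1]
  simp only [productConnection, h2 _ _ hX, h2 _ _ hY, fieldBracket, map_add, map_sub,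
    LinearMap.add_apply, LinearMap.sub_apply, productCurvature, LinearMap.comp_apply]
  abel

/-- The sum is `-tr(J R(X,Y))`, and `J` commutes with `Γ Y`, so only the term `Γ [X,Y]` survives. -/
theorem sum_productCurvature (hJ : IsInvariantComplexStructure J)
    (hg : IsInvariantHermitianMetric J g) (hΓ : ∀ X Y Z, g (Γ X Y) Z = bismutForm J g X Y Z)
    {ι : Type*} [Fintype ι] [DecidableEq ι] {E : Module.Basis ι ℝ su3}
    (hE : ∀ i j, g (E i) (E j) = if i = j then 1 else 0) (X Y : su3) :
    ∑ i, g (productCurvature Γ X Y (E i)) (J (E i))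
      = LinearMap.trace ℝ su3 (J ∘ₗ Γ (bracket X Y)) := by
  have h1 : ∑ i, g (productCurvature Γ X Y (E i)) (J (E i))
      = -LinearMap.trace ℝ su3 (J * productCurvature Γ X Y) := by
    rw [trace_eq_of_orthonormal hE, ← Finset.sum_neg_distrib]
    refine Finset.sum_congr rfl fun i _ => ?_
    rw [Module.End.mul_apply, map_left_eq_neg hJ.sq_eq_neg hg.hermitian, neg_neg]
  have hcomm : ∀ X, J * Γ X = Γ X * J := fun X =>
    LinearMap.ext fun Y => (bismut_complex hJ hg hΓ X Y).symm
  rw [h1, neg_eq_iff_eq_neg]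
  exact trace_mul_commutator_sub (hcomm Y)

/-- Of the six sums from `bismutForm`, two equal `tr(J ad X)` and two vanish because `ad (J X)` is
traceless. The other two each give the sum of `g([Eᵢ, JEᵢ], X)`; the factor `1/2` removes the
doubling. -/
theorem trace_bismut (hJ : IsInvariantComplexStructure J)
    (hg : IsInvariantHermitianMetric J g) (hΓ : ∀ X Y Z, g (Γ X Y) Z = bismutForm J g X Y Z)
    {ι : Type*} [Fintype ι] [DecidableEq ι] {E : Module.Basis ι ℝ su3}
    (hE : ∀ i j, g (E i) (E j) = if i = j then 1 else 0) (X : su3) :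
    LinearMap.trace ℝ su3 (J ∘ₗ Γ X)
      = LinearMap.trace ℝ su3 (J ∘ₗ adₗ X) + ∑ i, g (bracket (E i) (J (E i))) X := by
  have hl := map_left_eq_neg hJ.sq_eq_neg hg.hermitian
  have e1 : LinearMap.trace ℝ su3 (J * adₗ X) = LinearMap.trace ℝ su3 (adₗ X * J) :=
    LinearMap.trace_mul_comm _ _ _
  have e2 : LinearMap.trace ℝ su3 (J * adₗ (J X) * J) = 0 := by
    have := trace_mul_mul_of_mul_self (A := adₗ (J X)) (LinearMap.ext hJ.sq_eq_neg : J * J = -1)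
    rw [this, trace_adₗ, neg_zero]
  have e3 := trace_adₗ (J X)
  change LinearMap.trace ℝ su3 (J * Γ X) = LinearMap.trace ℝ su3 (J * adₗ X) + _
  have e4 : 2 * LinearMap.trace ℝ su3 (J * Γ X)
      = LinearMap.trace ℝ su3 (J * adₗ X) + LinearMap.trace ℝ su3 (adₗ X * J)
        - LinearMap.trace ℝ su3 (J * adₗ (J X) * J) + LinearMap.trace ℝ su3 (adₗ (J X))
        + 2 * ∑ i, g (bracket (E i) (J (E i))) X := by
    simp only [trace_eq_of_orthonormal hE, Finset.mul_sum, ← Finset.sum_add_distrib,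
      ← Finset.sum_sub_distrib]
    refine Finset.sum_congr rfl fun i _ => ?_
    simp only [Module.End.mul_apply, hl, hΓ, bismutForm, adₗ_apply, hJ.sq_eq_neg,
      bracket_neg_left, bracket_neg_right, map_neg, LinearMap.neg_apply]
    have h1 := metric_bracket_comm (g := g) X (J (E i)) (E i)
    have h2 := metric_bracket_comm (g := g) (J (E i)) (E i) X
    have h3 := metric_bracket_comm (g := g) (E i) (J X) (E i)
    linarith
  linarith

/-- The Calabi-Yau with torsion condition for left-invariant Hermitian structures. -/
theorem isCYT_iff (hJ : IsInvariantComplexStructure J)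
    (hg : IsInvariantHermitianMetric J g) (hΓ : ∀ X Y Z, g (Γ X Y) Z = bismutForm J g X Y Z) :
    IsCYT J g ↔ ∀ X Y, LinearMap.trace ℝ su3 (J ∘ₗ Γ (bracket X Y)) = 0 := by
  constructor
  · rintro ⟨D, hD, H⟩ X Y
    obtain ⟨E, hE⟩ := exists_orthonormal_basis hg.symm hg.pos
    have h := H E hE _ _ (isSmooth_const X) (isSmooth_const Y) 1
    rw [← sum_productCurvature hJ hg hΓ hE, ← h, ricciForm]
    refine Finset.sum_congr rfl fun i _ => ?_
    have hb : fieldBracket (fun _ => X) (fun _ => Y) = fun _ => bracket X Y :=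
      funext (fieldBracket_const X Y)
    rw [curvature, hb]
    simp only [hD.eq_product hJ hg hΓ]
    rfl
  · intro H
    refine ⟨productConnection Γ, isBismutConnection_productConnection hJ hg hΓ,
      fun E hE X Y hX hY p => ?_⟩
    simp only [ricciForm, curvature_productConnection hX hY, sum_productCurvature hJ hg hΓ hE, H]

end Bismut

/-! ### Coordinates with respect to a unitary frame -/

/-- The matrix of an element of `𝔰𝔲(3)` in the unitary frame `U`. -/
def inFrame (U : SU3) : su3 →ₗ[ℝ] Mat3 where
  toFun X := (U : Mat3)ᴴ * X * (U : Mat3)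
  map_add' X Y := by simp [mul_add, add_mul]
  map_smul' c X := by simp

section Frame

variable (U : SU3)

theorem inFrame_apply (X : su3) : inFrame U X = (U : Mat3)ᴴ * X * (U : Mat3) := rfl

theorem conj_conj (M : Mat3) : (U : Mat3)ᴴ * ((U : Mat3) * M * (U : Mat3)ᴴ) * (U : Mat3) = M := by
  rw [← mul_assoc, ← mul_assoc, conjTranspose_mul_self, one_mul, mul_assoc,
    conjTranspose_mul_self, mul_one]

theorem conj_conj' (M : Mat3) : (U : Mat3) * ((U : Mat3)ᴴ * M * (U : Mat3)) * (U : Mat3)ᴴ = M := by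
  rw [← mul_assoc, ← mul_assoc, mul_conjTranspose_self, one_mul, mul_assoc,
    mul_conjTranspose_self, mul_one]

theorem inFrame_injective : Function.Injective (inFrame U) := by
  intro X Y h
  apply Subtype.ext
  rw [← conj_conj' U X, ← conj_conj' U Y]
  simp only [inFrame_apply] at h
  rw [h]

@[simp] theorem inFrame_Ad (X : su3) : inFrame U (Ad U X) = X := conj_conj U X

theorem conj_mul_conj (M N : Mat3) : ((U : Mat3)ᴴ * M * (U : Mat3)) * ((U : Mat3)ᴴ * N * (U : Mat3))
    = (U : Mat3)ᴴ * (M * N) * (U : Mat3) := by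
  simp only [mul_assoc]
  rw [← mul_assoc (U : Mat3) (U : Mat3)ᴴ, mul_conjTranspose_self, one_mul]

theorem inFrame_bracket (X Y : su3) :
    inFrame U (bracket X Y) = inFrame U X * inFrame U Y - inFrame U Y * inFrame U X := by
  simp only [inFrame_apply, conj_mul_conj, coe_bracket, mul_sub, sub_mul]

theorem inFrame_Lam (a b c : ℝ) (X : su3) :
    inFrame U (Lam U a b c X) = weights a b c ⊙ inFrame U X := conj_conj U _

theorem conjTranspose_inFrame (X : su3) : (inFrame U X)ᴴ = -inFrame U X := by
  simp only [inFrame_apply, Matrix.conjTranspose_mul, Matrix.conjTranspose_conjTranspose,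
    su3.conjTranspose, mul_neg, neg_mul, mul_assoc]

theorem inFrame_swap (X : su3) (j k : Fin 3) : inFrame U X k j = -star (inFrame U X j k) := by
  have h := congrFun (congrFun (conjTranspose_inFrame U X) k) j
  rw [Matrix.conjTranspose_apply, Matrix.neg_apply] at h
  rw [h, neg_neg]

theorem inFrame_diag_re (X : su3) (j : Fin 3) : (inFrame U X j j).re = 0 := by
  have h := congrArg Complex.re (inFrame_swap U X j j)
  simp only [Complex.neg_re, Complex.star_def, Complex.conj_re] at h
  linarith

theorem trace_inFrame (X : su3) : (inFrame U X).trace = 0 := by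
  rw [inFrame_apply, Matrix.trace_mul_comm, ← mul_assoc, mul_conjTranspose_self, one_mul,
    su3.trace]

theorem B_eq_inFrame (X Y : su3) : B X Y = -6 * (inFrame U X * inFrame U Y).trace.re := by
  rw [B_apply, inFrame_apply, inFrame_apply, conj_mul_conj,
    Matrix.trace_mul_comm _ (U : Mat3), ← mul_assoc, mul_conjTranspose_self, one_mul]

theorem Lam_one (X : su3) : Lam U 1 1 1 X = X := by
  apply inFrame_injective U
  rw [inFrame_Lam]
  ext j k
  fin_cases j <;> fin_cases k <;> simp [weights]

theorem Lam_inv_Lam {a b c : ℝ} (ha : a ≠ 0) (hb : b ≠ 0) (hc : c ≠ 0) (X : su3) :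
    Lam U a b c (Lam U a⁻¹ b⁻¹ c⁻¹ X) = X := by
  apply inFrame_injective U
  rw [inFrame_Lam, inFrame_Lam]
  ext j k
  fin_cases j <;> fin_cases k <;> simp [weights, ha, hb, hc]

theorem metric_def (a b c : ℝ) (X Y : su3) : metric U a b c X Y = B (Lam U a b c X) Y := rfl

/-- The metric `B(Λ·,·)` in coordinates. -/
theorem metric_apply (a b c : ℝ) (X Y : su3) : metric U a b c X Y =
    6 * ∑ j, (inFrame U X j j * star (inFrame U Y j j)).re
      + 12 * (a * (inFrame U X 0 1 * star (inFrame U Y 0 1)).re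
        + b * (inFrame U X 1 2 * star (inFrame U Y 1 2)).re
        + c * (inFrame U X 0 2 * star (inFrame U Y 0 2)).re) := by
  rw [metric_def, B_eq_inFrame U, inFrame_Lam]
  have x1 := inFrame_swap U X 0 1
  have x2 := inFrame_swap U X 0 2
  have x3 := inFrame_swap U X 1 2
  have y1 := inFrame_swap U Y 0 1
  have y2 := inFrame_swap U Y 0 2
  have y3 := inFrame_swap U Y 1 2
  have d0 := inFrame_diag_re U Y 0
  have d1 := inFrame_diag_re U Y 1
  have d2 := inFrame_diag_re U Y 2
  simp only [Matrix.trace, Matrix.diag_apply, Matrix.mul_apply, Fin.sum_univ_three,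
    Matrix.hadamard_apply, x1, x2, x3, y1, y2, y3]
  simp [weights, d0, d1, d2]
  ring

theorem B_eq_metric (X Y : su3) : B X Y = metric U 1 1 1 X Y := by
  rw [metric_def, Lam_one]

/-- The real part `E_{jk} - E_{kj}` of a root vector. -/
def rootRe {j k : Fin 3} (h : j ≠ k) : su3 :=
  Ad U ⟨Matrix.single j k 1 - Matrix.single k j 1, by simp, by simp [h, h.symm]⟩

/-- The imaginary part `i(E_{jk} + E_{kj})` of a root vector. -/
def rootIm {j k : Fin 3} (h : j ≠ k) : su3 :=
  Ad U ⟨Complex.I • (Matrix.single j k 1 + Matrix.single k j 1), by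
    rw [Matrix.conjTranspose_smul, Matrix.conjTranspose_add, Matrix.conjTranspose_single,
      Matrix.conjTranspose_single, star_one, Complex.star_def, Complex.conj_I, neg_smul, add_comm],
    by simp [h, h.symm]⟩

theorem inFrame_rootRe {j k : Fin 3} (h : j ≠ k) :
    inFrame U (rootRe U h) = Matrix.single j k 1 - Matrix.single k j 1 := inFrame_Ad U _

theorem inFrame_rootIm {j k : Fin 3} (h : j ≠ k) :
    inFrame U (rootIm U h) = Complex.I • (Matrix.single j k 1 + Matrix.single k j 1) :=
  inFrame_Ad U _

theorem B_rootRe (X : su3) {j k : Fin 3} (h : j ≠ k) :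
    B X (rootRe U h) = 12 * (inFrame U X j k).re := by
  rw [B_eq_inFrame U, inFrame_rootRe, mul_sub, Matrix.trace_sub, Matrix.trace_mul_single,
    Matrix.trace_mul_single, inFrame_swap U X j k]
  simp
  ring

theorem B_rootIm (X : su3) {j k : Fin 3} (h : j ≠ k) :
    B X (rootIm U h) = 12 * (inFrame U X j k).im := by
  rw [B_eq_inFrame U, inFrame_rootIm, mul_smul_comm, mul_add, Matrix.trace_smul, Matrix.trace_add,
    Matrix.trace_mul_single, Matrix.trace_mul_single, inFrame_swap U X j k]
  simp
  ring

/-- The matrix in `𝔰𝔲(3)` with given real coordinates. -/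
def ofCoords (v : Fin 8 → ℝ) : su3 :=
  ⟨!![Complex.I * v 6, v 0 + Complex.I * v 1, v 2 + Complex.I * v 3;
      -v 0 + Complex.I * v 1, Complex.I * v 7, v 4 + Complex.I * v 5;
      -v 2 + Complex.I * v 3, -v 4 + Complex.I * v 5, -Complex.I * (v 6 + v 7)], by
    ext i j
    fin_cases i <;> fin_cases j <;> simp <;> ring, by
    simp [Matrix.trace, Fin.sum_univ_three]; ring⟩

/-- Real coordinates on `𝔰𝔲(3)` with respect to a unitary frame. -/
def coords : su3 ≃ₗ[ℝ] (Fin 8 → ℝ) where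
  toFun X := ![(inFrame U X 0 1).re, (inFrame U X 0 1).im, (inFrame U X 0 2).re,
    (inFrame U X 0 2).im, (inFrame U X 1 2).re, (inFrame U X 1 2).im, (inFrame U X 0 0).im,
    (inFrame U X 1 1).im]
  invFun v := Ad U (ofCoords v)
  map_add' X Y := by
    ext i
    fin_cases i <;> simp
  map_smul' c X := by
    ext i
    fin_cases i <;> simp
  left_inv X := by
    apply inFrame_injective U
    rw [inFrame_Ad]
    have x1 := inFrame_swap U X 0 1
    have x2 := inFrame_swap U X 0 2
    have x3 := inFrame_swap U X 1 2
    have d0 := inFrame_diag_re U X 0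
    have d1 := inFrame_diag_re U X 1
    have d2 := inFrame_diag_re U X 2
    have ht := congrArg Complex.im (trace_inFrame U X)
    simp only [Matrix.trace, Matrix.diag_apply, Fin.sum_univ_three, Complex.add_im,
      Complex.zero_im] at ht
    ext i j
    fin_cases i <;> fin_cases j <;> apply Complex.ext <;>
      simp [ofCoords, x1, x2, x3, d0, d1, d2]
    linarith
  right_inv v := by
    simp only [inFrame_Ad]
    ext i
    fin_cases i <;> simp [ofCoords]

theorem trace_eq_coords (f : su3 →ₗ[ℝ] su3) : LinearMap.trace ℝ su3 f
    = ∑ i, coords U (f (Ad U (ofCoords (Pi.single i 1)))) i := by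
  rw [LinearMap.trace_eq_matrix_trace ℝ (Module.Basis.ofEquivFun (coords U)), Matrix.trace]
  refine Finset.sum_congr rfl fun i _ => ?_
  rw [Matrix.diag_apply, LinearMap.toMatrix_apply, Module.Basis.ofEquivFun_repr_apply,
    Module.Basis.coe_ofEquivFun]
  rfl

end Frame

/-! ### Complex structures adapted to a frame -/

section Adapted

variable {U : SU3} {J : su3 →ₗ[ℝ] su3}

/-- The conjugate transpose sends `X + iY` to `-X + iY`, which separates the two parts. -/
theorem eq_of_add_I_smul_eq {X Y X' Y' : su3}
    (h : (X : Mat3) + Complex.I • (Y : Mat3) = (X' : Mat3) + Complex.I • (Y' : Mat3)) :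
    X = X' ∧ Y = Y' := by
  have h2 := congrArg Matrix.conjTranspose h
  simp only [Matrix.conjTranspose_add, Matrix.conjTranspose_smul, su3.conjTranspose,
    Complex.star_def, Complex.conj_I] at h2
  constructor
  · apply Subtype.ext
    ext i j
    have a := congrFun (congrFun h i) j
    have b := congrFun (congrFun h2 i) j
    simp only [Matrix.add_apply, Matrix.smul_apply, Matrix.neg_apply, smul_eq_mul] at a b
    linear_combination (a - b) / 2
  · apply Subtype.ext
    ext i j
    have a := congrFun (congrFun h i) j
    have b := congrFun (congrFun h2 i) j
    simp only [Matrix.add_apply, Matrix.smul_apply, Matrix.neg_apply, smul_eq_mul] at a b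
    linear_combination (-Complex.I / 2) * (a + b) + ((Y : Mat3) i j - (Y' : Mat3) i j)
      * Complex.I_mul_I

theorem rootRe_sub_I_smul_rootIm {j k : Fin 3} (h : j ≠ k) :
    (((1 / 2 : ℝ) • rootRe U h : su3) : Mat3)
        + Complex.I • (((-1 / 2 : ℝ) • rootIm U h : su3) : Mat3)
      = (U : Mat3) * Matrix.single j k 1 * (U : Mat3)ᴴ := by
  have : (Matrix.single j k 1 : Mat3) = (1 / 2 : ℝ) • (Matrix.single j k 1 - Matrix.single k j 1)
      + Complex.I • ((-1 / 2 : ℝ) • (Complex.I • (Matrix.single j k 1 + Matrix.single k j 1))) := by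
    ext a b
    simp only [Matrix.add_apply, Matrix.smul_apply, Matrix.sub_apply, smul_eq_mul,
      Complex.real_smul]
    push_cast
    linear_combination ((Matrix.single j k 1 : Mat3) a b + (Matrix.single k j 1 : Mat3) a b) / 2
      * Complex.I_mul_I
  rw [this, mul_add, add_mul, mul_smul_comm, smul_mul_assoc, mul_smul_comm, smul_mul_assoc,
    mul_smul_comm, smul_mul_assoc]
  rfl

theorem IsAdapted.map_rootRe (h : IsAdapted J U) {j k : Fin 3} (hjk : j < k) :
    J (rootRe U hjk.ne) = rootIm U hjk.ne ∧ J (rootIm U hjk.ne) = -rootRe U hjk.ne := by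
  obtain ⟨X, Y, h1, h2⟩ := h j k hjk
  rw [← rootRe_sub_I_smul_rootIm hjk.ne] at h1
  obtain ⟨rfl, rfl⟩ := eq_of_add_I_smul_eq h1
  set P := rootRe U hjk.ne
  set Q := rootIm U hjk.ne
  have h3 : ((J ((1 / 2 : ℝ) • P) : su3) : Mat3) + Complex.I • ((J ((-1 / 2 : ℝ) • Q) : su3) : Mat3)
      = (((1 / 2 : ℝ) • Q : su3) : Mat3) + Complex.I • (((1 / 2 : ℝ) • P : su3) : Mat3) := by
    rw [h2]
    ext a b
    simp only [Matrix.add_apply, Matrix.smul_apply, smul_eq_mul, Submodule.coe_smul,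
      Complex.real_smul]
    push_cast
    linear_combination (-1 / 2) * (Q : Mat3) a b * Complex.I_mul_I
  obtain ⟨h4, h5⟩ := eq_of_add_I_smul_eq h3
  rw [map_smul] at h4 h5
  refine ⟨smul_right_injective _ (by norm_num : (1 / 2 : ℝ) ≠ 0) h4,
    smul_right_injective _ (by norm_num : (-1 / 2 : ℝ) ≠ 0) ?_⟩
  refine h5.trans ?_
  change _ = (-1 / 2 : ℝ) • -P
  rw [smul_neg, ← neg_smul]
  norm_num

variable (h : IsAdapted J U) (hsq : ∀ X, J (J X) = -X) (hB : ∀ X Y, B (J X) (J Y) = B X Y)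

include h hsq hB

/-- The entry `(j,k)` is read off by pairing under `B` with `rootRe` and `rootIm`, and `J`, being
skew, moves onto these. -/
theorem IsAdapted.inFrame_map (X : su3) {j k : Fin 3} (hjk : j < k) :
    inFrame U (J X) j k = Complex.I * inFrame U X j k := by
  have hl := map_left_eq_neg hsq hB
  obtain ⟨h1, h2⟩ := h.map_rootRe hjk
  have e1 := B_rootRe U (J X) hjk.ne
  have e2 := B_rootIm U (J X) hjk.ne
  rw [hl, h1, B_rootIm] at e1
  rw [hl, h2, map_neg, neg_neg, B_rootRe] at e2
  apply Complex.ext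
  · simp only [Complex.mul_re, Complex.I_re, Complex.I_im]
    linarith
  · simp only [Complex.mul_im, Complex.I_re, Complex.I_im]
    linarith

theorem IsAdapted.inFrame_map_diag {X : su3} (hX : ∀ j, inFrame U X j j = 0) (j : Fin 3) :
    inFrame U (J X) j j = 0 := by
  -- With zero weights `Lam` projects onto the Cartan subalgebra. `J H` has no off-diagonal part and
  -- `X` no diagonal part, so `B(JX, H) = -B(X, JH) = 0`, while `B(JX, H)` is the squared norm of
  -- `H`.
  set H := Lam U 0 0 0 (J X) with hH
  have hoff : ∀ j k, j < k → inFrame U (J H) j k = 0 := by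
    intro j k hjk
    rw [h.inFrame_map hsq hB H hjk, hH, inFrame_Lam]
    fin_cases j <;> fin_cases k <;> simp_all [weights]
  have h1 : B (J X) H = 0 := by
    rw [map_left_eq_neg hsq hB, B_eq_metric U, metric_apply]
    simp [hX, hoff]
  rw [B_comm, hH, ← metric_def, metric_apply] at h1
  have h2 : ∑ j, Complex.normSq (inFrame U (J X) j j) = 0 := by
    simp only [Complex.star_def, Complex.mul_conj, Complex.ofReal_re, zero_mul, add_zero,
      mul_zero] at h1
    linarith
  rw [Finset.sum_eq_zero_iff_of_nonneg fun j _ => Complex.normSq_nonneg _] at h2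
  exact Complex.normSq_eq_zero.1 (h2 j (Finset.mem_univ j))

/-- The metrics `B(Λ·,·)` are Hermitian. -/
theorem IsAdapted.isInvariantHermitianMetric {a b c : ℝ} (ha : 0 < a) (hb : 0 < b) (hc : 0 < c) :
    IsInvariantHermitianMetric J (metric U a b c) where
  symm X Y := by
    have : ∀ z w : ℂ, (z * star w).re = (w * star z).re := by
      intro z w
      simp only [Complex.star_def, Complex.mul_re, Complex.conj_re, Complex.conj_im]
      ring
    rw [metric_apply, metric_apply]
    simp only [this (inFrame U X _ _)]
  pos X hX := by
    have h1 := B_pos hX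
    rw [B_eq_metric U, metric_apply] at h1
    rw [metric_apply]
    simp only [Complex.star_def, Complex.mul_conj, Complex.ofReal_re] at h1 ⊢
    have hd : 0 ≤ ∑ j, Complex.normSq (inFrame U X j j) :=
      Finset.sum_nonneg fun j _ => Complex.normSq_nonneg _
    have n1 := Complex.normSq_nonneg (inFrame U X 0 1)
    have n2 := Complex.normSq_nonneg (inFrame U X 1 2)
    have n3 := Complex.normSq_nonneg (inFrame U X 0 2)
    by_contra hle
    have m1 := mul_nonneg ha.le n1
    have m2 := mul_nonneg hb.le n2
    have m3 := mul_nonneg hc.le n3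
    have z1 : Complex.normSq (inFrame U X 0 1) = 0 :=
      (mul_eq_zero.1 (by linarith : a * Complex.normSq (inFrame U X 0 1) = 0)).resolve_left ha.ne'
    have z2 : Complex.normSq (inFrame U X 1 2) = 0 :=
      (mul_eq_zero.1 (by linarith : b * Complex.normSq (inFrame U X 1 2) = 0)).resolve_left hb.ne'
    have z3 : Complex.normSq (inFrame U X 0 2) = 0 :=
      (mul_eq_zero.1 (by linarith : c * Complex.normSq (inFrame U X 0 2) = 0)).resolve_left hc.ne'
    rw [z1, z2, z3] at h1 hle
    linarith
  hermitian X Y := by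
    have hI : ∀ z w : ℂ, (Complex.I * z * star (Complex.I * w)).re = (z * star w).re := by
      intro z w
      simp only [Complex.star_def, map_mul, Complex.conj_I]
      congr 1
      linear_combination (-z * (starRingEnd ℂ) w) * Complex.I_mul_I
    -- The action of `J` on the Cartan part is unspecified; its orthogonality there follows from
    -- that of `B`, as the root parts already agree.
    have h1 := hB X Y
    rw [B_eq_metric U, B_eq_metric U, metric_apply, metric_apply] at h1
    rw [metric_apply, metric_apply]
    simp only [h.inFrame_map hsq hB _ (show (0 : Fin 3) < 1 by decide),
      h.inFrame_map hsq hB _ (show (1 : Fin 3) < 2 by decide),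
      h.inFrame_map hsq hB _ (show (0 : Fin 3) < 2 by decide), hI] at h1 ⊢
    linarith

/-- The trace that governs the Ricci form, in coordinates. -/
theorem IsAdapted.trace_sub_trace {a b c : ℝ} (Z : su3) :
    LinearMap.trace ℝ su3 (J ∘ₗ adₗ Z)
        - LinearMap.trace ℝ su3 (Lam U a⁻¹ b⁻¹ c⁻¹ ∘ₗ J ∘ₗ adₗ (Lam U a b c Z))
      = -2 * ((1 - a⁻¹) * ((inFrame U Z 0 0).im - (inFrame U Z 1 1).im)
        + (1 - b⁻¹) * ((inFrame U Z 1 1).im - (inFrame U Z 2 2).im)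
        + (1 - c⁻¹) * ((inFrame U Z 0 0).im - (inFrame U Z 2 2).im)) := by
  have h01 : ∀ X, inFrame U (J X) 0 1 = Complex.I * inFrame U X 0 1 := fun X =>
    h.inFrame_map hsq hB X (by decide)
  have h02 : ∀ X, inFrame U (J X) 0 2 = Complex.I * inFrame U X 0 2 := fun X =>
    h.inFrame_map hsq hB X (by decide)
  have h12 : ∀ X, inFrame U (J X) 1 2 = Complex.I * inFrame U X 1 2 := fun X =>
    h.inFrame_map hsq hB X (by decide)
  -- Coordinates `6` and `7` are the Cartan ones. Since `[Z, H]` has zero diagonal for `H` in the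
  -- Cartan subalgebra, so has its image under `J`; these coordinates add nothing to the trace.
  have hdiag : ∀ (Z : su3) (i : Fin 8) (j : Fin 3), 6 ≤ i →
      inFrame U (J (bracket Z (Ad U (ofCoords (Pi.single i 1))))) j j = 0 := by
    intro Z i j hi
    apply h.inFrame_map_diag hsq hB
    intro j
    rw [inFrame_bracket, inFrame_Ad]
    simp only [Matrix.sub_apply, Matrix.mul_apply, Fin.sum_univ_three]
    fin_cases i <;> first | (exfalso; revert hi; decide) | skip
    all_goals
      fin_cases j <;> simp [ofCoords] <;> ring
  have hL : ∀ (a b c : ℝ) (X : su3) j k,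
      inFrame U (Lam U a b c X) j k = weights a b c j k * inFrame U X j k := by
    intro a b c X j k
    rw [inFrame_Lam, Matrix.hadamard_apply]
  have hd := fun Z => hdiag Z 6
  have hd' := fun Z => hdiag Z 7
  rw [trace_eq_coords U, trace_eq_coords U]
  simp only [Fin.sum_univ_eight, coords, LinearEquiv.coe_mk, LinearMap.coe_mk, AddHom.coe_mk,
    LinearMap.comp_apply, adₗ_apply]
  simp only [hL, h01, h02, h12, Matrix.cons_val, hd _ 0 (by decide), hd' _ 1 (by decide),
    inFrame_bracket, inFrame_Ad, Matrix.sub_apply, Matrix.mul_apply, Fin.sum_univ_three]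
  simp [ofCoords, weights]
  ring

end Adapted

/-! ### The CYT equations, torus invariance and injectivity of the family -/

theorem sum_metric_bracket {U : SU3} {J : su3 →ₗ[ℝ] su3} (hsq : ∀ X, J (J X) = -X)
    (hB : ∀ X Y, B (J X) (J Y) = B X Y) {a b c : ℝ} (ha : a ≠ 0) (hb : b ≠ 0) (hc : c ≠ 0)
    (hs : ∀ X Y, metric U a b c X Y = metric U a b c Y X)
    {ι : Type*} [Fintype ι] [DecidableEq ι] {E : Module.Basis ι ℝ su3}
    (hE : ∀ i j, metric U a b c (E i) (E j) = if i = j then 1 else 0) (Z : su3) :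
    ∑ i, metric U a b c (bracket (E i) (J (E i))) Z
      = -LinearMap.trace ℝ su3 (Lam U a⁻¹ b⁻¹ c⁻¹ ∘ₗ J ∘ₗ adₗ (Lam U a b c Z)) := by
  -- Termwise, `B(Λ[Eᵢ,JEᵢ], Z) = B([ΛZ,Eᵢ], JEᵢ) = -B(J[ΛZ,Eᵢ], Eᵢ)` by symmetry, ad-invariance and
  -- skewness of `J`; inserting `Λ Λ⁻¹` turns `B` back into the metric.
  rw [trace_eq_of_orthonormal hE, ← Finset.sum_neg_distrib]
  refine Finset.sum_congr rfl fun i _ => ?_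
  rw [LinearMap.comp_apply, LinearMap.comp_apply, adₗ_apply, metric_def U a b c (Lam U _ _ _ _),
    Lam_inv_Lam U ha hb hc, map_left_eq_neg hsq hB, B_bracket, neg_neg, hs, metric_def]

/-- The Calabi-Yau with torsion condition for the metrics `B(Λ·,·)`. -/
theorem IsAdapted.isCYT_metric_iff {U : SU3} {J : su3 →ₗ[ℝ] su3} (h : IsAdapted J U)
    (hJ : IsInvariantComplexStructure J) (hB : ∀ X Y, B (J X) (J Y) = B X Y) {a b c : ℝ}
    (ha : 0 < a) (hb : 0 < b) (hc : 0 < c) :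
    IsCYT J (metric U a b c) ↔ a⁻¹ + c⁻¹ = 2 ∧ b⁻¹ + c⁻¹ = 2 := by
  have hsq := hJ.sq_eq_neg
  have hg := h.isInvariantHermitianMetric hsq hB ha hb hc
  obtain ⟨Γ, hΓ⟩ := exists_bismutProduct hg
  obtain ⟨E, hE⟩ := exists_orthonormal_basis hg.symm hg.pos
  have hθ : ∀ Z, LinearMap.trace ℝ su3 (J ∘ₗ Γ Z)
      = -2 * ((1 - a⁻¹) * ((inFrame U Z 0 0).im - (inFrame U Z 1 1).im)
        + (1 - b⁻¹) * ((inFrame U Z 1 1).im - (inFrame U Z 2 2).im)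
        + (1 - c⁻¹) * ((inFrame U Z 0 0).im - (inFrame U Z 2 2).im)) := by
    intro Z
    rw [trace_bismut hJ hg hΓ hE, sum_metric_bracket hsq hB ha.ne' hb.ne' hc.ne' hg.symm hE,
      ← sub_eq_add_neg, h.trace_sub_trace hsq hB]
  rw [isCYT_iff hJ hg hΓ]
  simp only [hθ]
  constructor
  · intro H
    -- These brackets are multiples of the simple coroots. Pairing with the roots gives a linear
    -- system with the Cartan matrix, equivalent to the two equations.
    have h1 := H (rootRe U (show (0 : Fin 3) ≠ 1 by decide))
      (rootIm U (show (0 : Fin 3) ≠ 1 by decide))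
    have h2 := H (rootRe U (show (1 : Fin 3) ≠ 2 by decide))
      (rootIm U (show (1 : Fin 3) ≠ 2 by decide))
    simp only [inFrame_bracket, inFrame_rootRe, inFrame_rootIm, Matrix.sub_apply, Matrix.mul_apply,
      Fin.sum_univ_three, Matrix.smul_apply, Matrix.add_apply] at h1 h2
    simp at h1 h2
    constructor <;> linarith
  · rintro ⟨h1, h2⟩ X Y
    -- Now `1 - a⁻¹ = 1 - b⁻¹ = -(1 - c⁻¹)`, and the terms of `α` and `β` cancel that of `α + β`.
    have e1 : a⁻¹ = 2 - c⁻¹ := by linarith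
    have e2 : b⁻¹ = 2 - c⁻¹ := by linarith
    rw [e1, e2]
    ring

/-- The metrics `B(Λ·,·)` are invariant under right translations by the torus. -/
theorem isTorusInvariant_metric (U : SU3) (a b c : ℝ) : IsTorusInvariant U (metric U a b c) := by
  intro V hV X Y
  set D : Mat3 := (U : Mat3)ᴴ * (V : Mat3) * (U : Mat3) with hD
  have hDD : Dᴴ = (U : Mat3)ᴴ * (V : Mat3)ᴴ * (U : Mat3) := by
    rw [hD, Matrix.conjTranspose_mul, Matrix.conjTranspose_mul, Matrix.conjTranspose_conjTranspose,
      mul_assoc]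
  have hDu : D * Dᴴ = 1 := by
    rw [hDD, hD, conj_mul_conj, mul_conjTranspose_self, mul_one, conjTranspose_mul_self]
  have hdiag := hV.diagonal_diag
  set d := D.diag
  have hd : ∀ j, d j * star (d j) = 1 := by
    intro j
    have h := congrFun (congrFun hDu j) j
    rw [← hdiag, Matrix.diagonal_conjTranspose, Matrix.diagonal_mul_diagonal,
      Matrix.diagonal_apply_eq, Matrix.one_apply_eq] at h
    exact h
  -- A torus element multiplies each entry by a phase, which cancels in the Hermitian products
  -- making up the metric.
  have hAd : ∀ X j k, inFrame U (Ad V X) j k = d j * inFrame U X j k * star (d k) := by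
    intro X j k
    have h1 : inFrame U (Ad V X) = D * inFrame U X * Dᴴ := by
      rw [hDD, hD, inFrame_apply, inFrame_apply, conj_mul_conj, conj_mul_conj]
      rfl
    rw [h1, ← hdiag, Matrix.diagonal_conjTranspose, Matrix.mul_diagonal, Matrix.diagonal_mul]
    rfl
  have hprod : ∀ j k, inFrame U (Ad V X) j k * star (inFrame U (Ad V Y) j k)
      = inFrame U X j k * star (inFrame U Y j k) := by
    intro j k
    rw [hAd, hAd, star_mul', star_mul', star_star]
    linear_combination (inFrame U X j k * star (inFrame U Y j k)) * (d k * star (d k)) * hd j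
      + (inFrame U X j k * star (inFrame U Y j k)) * hd k
  rw [metric_apply, metric_apply]
  simp only [hprod]

/-- The vector `rootRe` of the root `α` has squared length `12a`. -/
theorem metric_injective_left {U : SU3} {a b c a' b' c' : ℝ}
    (h : metric U a b c = metric U a' b' c') : a = a' := by
  have h1 := congrArg (fun g : su3 →ₗ[ℝ] su3 →ₗ[ℝ] ℝ =>
    g (rootRe U (show (0 : Fin 3) ≠ 1 by decide)) (rootRe U (show (0 : Fin 3) ≠ 1 by decide))) h
  simp only [metric_apply, inFrame_rootRe, Fin.sum_univ_three, Matrix.sub_apply] at h1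
  simpa [Matrix.single_apply] using h1

end SU3Geometry

end

theorem proposition2 (J : SU3Geometry.su3 →ₗ[ℝ] SU3Geometry.su3)
    (hJ : SU3Geometry.IsInvariantComplexStructure J)
    (hB : ∀ X Y, SU3Geometry.B (J X) (J Y) = SU3Geometry.B X Y) :
    (∃ U : SU3Geometry.SU3, SU3Geometry.IsAdapted J U) ∧
    ∀ U : SU3Geometry.SU3, SU3Geometry.IsAdapted J U →
      (∀ a b c : ℝ, 0 < a → 0 < b → 0 < c →
        SU3Geometry.IsInvariantHermitianMetric J (SU3Geometry.metric U a b c) ∧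
        SU3Geometry.IsTorusInvariant U (SU3Geometry.metric U a b c) ∧
        (SU3Geometry.IsCYT J (SU3Geometry.metric U a b c) ↔
          a⁻¹ + c⁻¹ = 2 ∧ b⁻¹ + c⁻¹ = 2)) ∧
      Set.BijOn (fun t : ℝ => SU3Geometry.metric U t⁻¹ t⁻¹ (2 - t)⁻¹) (Set.Ioo 0 2)
        {g | SU3Geometry.IsCYT J g ∧
          ∃ a b c : ℝ, 0 < a ∧ 0 < b ∧ 0 < c ∧ g = SU3Geometry.metric U a b c} := by
  refine ⟨hJ.exists_isAdapted hB, fun U hU => ⟨fun a b c ha hb hc =>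
    ⟨hU.isInvariantHermitianMetric hJ.sq_eq_neg hB ha hb hc,
      SU3Geometry.isTorusInvariant_metric U a b c, hU.isCYT_metric_iff hJ hB ha hb hc⟩,
    ?_, ?_, ?_⟩⟩
  · rintro t ⟨h0, h2⟩
    have h1 : 0 < t⁻¹ := inv_pos.2 h0
    have h3 : 0 < (2 - t)⁻¹ := inv_pos.2 (by linarith)
    refine ⟨(hU.isCYT_metric_iff hJ hB h1 h1 h3).2 ?_, _, _, _, h1, h1, h3, rfl⟩
    simp only [inv_inv]
    constructor <;> ring
  · intro t _ t' _ h
    exact inv_injective (SU3Geometry.metric_injective_left h)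
  · rintro _ ⟨hg, a, b, c, ha, hb, hc, rfl⟩
    obtain ⟨h1, h2⟩ := (hU.isCYT_metric_iff hJ hB ha hb hc).1 hg
    have hc' := inv_pos.2 hc
    -- The parameter is `t = 1/λ_α`; it is below `2` because `2 - t = c⁻¹ > 0`.
    refine ⟨a⁻¹, ⟨inv_pos.2 ha, by linarith⟩, ?_⟩
    have e1 : a = b := inv_injective (by linarith)
    have e2 : (2 : ℝ) - a⁻¹ = c⁻¹ := by linarith
    simp only [inv_inv, e2, ← e1]
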